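/- Let $\mathcal H$, $\mathcal G$ be complex Hilbert spaces and let $\mathfrak h$ be a closed, densely defined, non-negative quadratic form in $\mathcal H$ with domain $\mathcal H^1$, normed by $\|u\|_1^2=\|u\|^2+\mathfrak h(u)$. Let $(\Gamma,\mathcal G)$ be a boundary pair associated with $\mathfrak h$, i.e. $\Gamma:\mathcal H^1\to\mathcal G$ is a bounded linear operator with dense range $\mathcal G^{1/2}:=\operatorname{ran}\Gamma$ (here $\ker\Gamma$ need not be dense in $\mathcal H$). Notation. $H^{N}\ge 0$ is the operator in $\mathcal H$ associated with $\mathfrak h$, and $H^{D}$ is the operator in $\overline{\ker\Gamma}\subset\mathcal H$ associated with $\mathfrak h|_{\ker\Gamma}$. For $z\in\mathbb C$ let $\mathcal L^1(z)=\{u\in\mathcal H^1:\mathfrak h(u,f)=z\langle u,f\rangle\ \text{for all } f\in\ker\Gamma\}$. For $z\notin\operatorname{spec}H^D$ the map $\Gamma|_{\mathcal L^1(z)}:\mathcal L^1(z)\to\mathcal G^{1/2}$ is bijective, and $S(z):\mathcal G^{1/2}\to\mathcal H^1$ denotes its inverse; $S:=S(-1)$, and $\mathcal G^{1/2}$ is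 normed by $\|\varphi\|_{1/2}=\|S\varphi\|_1$. The Dirichlet-to-Neumann operator $\Lambda(z)$ is the operator in $\mathcal G$ associated with the sesquilinear form $\mathfrak l_z(\varphi,\psi)=\mathfrak h(S(z)\varphi,S\psi)-z\langle S(z)\varphi,S\psi\rangle$ on $\mathcal G^{1/2}$: $\varphi\in\operatorname{dom}\Lambda(z)\subset\mathcal G^{1/2}$ and $\Lambda(z)\varphi=\eta\in\mathcal G$ iff $\mathfrak l_z(\varphi,\psi)=\langle\eta,\psi\rangle_{\mathcal G}$ for all $\psi\in\mathcal G^{1/2}$. The spectrum of an operator $T$ is the set of $z$ for which $T-z$ has no bounded, everywhere defined inverse; $\operatorname{spec}_p$ is the set of eigenvalues; $\operatorname{spec}_{disc}$ is the set of eigenvalues that are isolated points of the spectrum and have finite algebraic multiplicity $\dim\bigcup_k\ker(T-z)^k$; the spectrum is purely discrete if $\operatorname{spec}T=\operatorname{spec}_{disc}T$. Theorem. Let $\lambda\in\mathbb C\setminus\operatorname{spec}H^D$. (i) $S(\lambda)$ is a topological isomorphism from $\ker\Lambda(\lambda)\subset\mathcal G^{1/2}$ (with $\|\cdot\|_{1/2}$)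 onto $\ker(H^N-\lambda)$ (with $\|\cdot\|_1$, and equally with the norm of $\mathcal H$), with inverse $\Gamma$. In particular, $\lambda\in\operatorname{spec}_pH^N\iff 0\in\operatorname{spec}_p\Lambda(\lambda)$, and $\dim\ker(H^N-\lambda)=\dim\ker\Lambda(\lambda)$. (ii) If $(H^N+1)^{-1}:\mathcal H\to\mathcal H$ and $\Gamma:\mathcal H^1\to\mathcal G$ are compact, then the spectra of $H^N$, $H^D$ and $\Lambda(\lambda)$ are purely discrete, and the equivalence in (i) also holds with $\operatorname{spec}_p$ replaced by $\operatorname{spec}_{disc}$ and with $\operatorname{spec}_p$ replaced by $\operatorname{spec}$. (iii) If $\lambda$ is an isolated point of $\operatorname{spec}H^N$, then for all $z\ne\lambda$ in some neighbourhood of $\lambda$ one has $z\notin\operatorname{spec}H^D\cup\operatorname{spec}H^N$, $\Lambda(z)$ has a bounded, everywhere defined inverse in $\mathcal G$, and $$\|\Lambda(z)^{-1}\|_{\mathcal G\to\mathcal G}\le\frac{C_\lambda}{|z-\lambda|},$$ where $C_\lambda>0$ depends only on $\|\Gamma\|_{\mathcal H^1\to\mathcal G}$, $\lambda$ and $\operatorname{spec}H^N$.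 -/

import Mathlib

open scoped ComplexConjugate Topology

universe u v

noncomputable section

/-! ### Unbounded operators: eigenspaces, spectrum, discrete spectrum -/

section Operators

variable {K : Type*} [NormedAddCommGroup K] [InnerProductSpace ℂ K]

/-- The submodule of all `x ∈ dom T` with `(T - z) x ∈ W`. -/
def LinearPMap.shiftComap (T : K →ₗ.[ℂ] K) (z : ℂ) (W : Submodule ℂ K) : Submodule ℂ K where
  carrier := {x | ∃ hx : x ∈ T.domain, T ⟨x, hx⟩ - z • x ∈ W}
  zero_mem' := ⟨T.domain.zero_mem, by
    have h0 : T ⟨0, T.domain.zero_mem⟩ = 0 := T.map_zero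
    rw [h0]; simp⟩
  add_mem' := by
    rintro x y ⟨hx, hx'⟩ ⟨hy, hy'⟩
    refine ⟨T.domain.add_mem hx hy, ?_⟩
    have h : T ⟨x + y, T.domain.add_mem hx hy⟩ = T ⟨x, hx⟩ + T ⟨y, hy⟩ :=
      T.map_add ⟨x, hx⟩ ⟨y, hy⟩
    rw [h, smul_add, add_sub_add_comm]
    exact W.add_mem hx' hy'
  smul_mem' := by
    rintro c x ⟨hx, hx'⟩
    refine ⟨T.domain.smul_mem c hx, ?_⟩
    have h : T ⟨c • x, T.domain.smul_mem c hx⟩ = c • T ⟨x, hx⟩ := T.map_smul c ⟨x, hx⟩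
    rw [h, smul_comm z c x, ← smul_sub]
    exact W.smul_mem c hx'

/-- The eigenspace `ker (T - z)`. -/
def LinearPMap.eigenspace (T : K →ₗ.[ℂ] K) (z : ℂ) : Submodule ℂ K := T.shiftComap z ⊥

/-- The kernel of `(T - z) ^ k`, with its natural domain. -/
def LinearPMap.genEigenspace (T : K →ₗ.[ℂ] K) (z : ℂ) : ℕ → Submodule ℂ K
  | 0 => ⊥
  | k + 1 => T.shiftComap z (LinearPMap.genEigenspace T z k)

/-- `B` is an everywhere defined bounded two-sided inverse of `T - z : dom T → K`. -/
def LinearPMap.IsResolvent (T : K →ₗ.[ℂ] K) (z : ℂ) (B : K →L[ℂ] K) : Prop :=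
  (∀ x : T.domain, B (T x - z • (x : K)) = x) ∧
    ∀ y : K, ∃ hy : B y ∈ T.domain, T ⟨B y, hy⟩ - z • B y = y

/-- The spectrum: all `z` for which `T - z` has no bounded everywhere defined inverse. -/
def LinearPMap.spec (T : K →ₗ.[ℂ] K) : Set ℂ := {z | ¬ ∃ B : K →L[ℂ] K, T.IsResolvent z B}

/-- The point spectrum: the set of eigenvalues. -/
def LinearPMap.pointSpec (T : K →ₗ.[ℂ] K) : Set ℂ := {z | T.eigenspace z ≠ ⊥}

/-- `z` is an isolated point of the set `s`. -/
def IsIsolatedIn (z : ℂ) (s : Set ℂ) : Prop := z ∈ s ∧ ∀ᶠ w in 𝓝[≠] z, w ∉ s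

/-- The discrete spectrum: the eigenvalues that are isolated points of the spectrum and have
finite algebraic multiplicity (which is the dimension of `⋃ k, ker (T - z) ^ k`). -/
def LinearPMap.discSpec (T : K →ₗ.[ℂ] K) : Set ℂ :=
  {z | IsIsolatedIn z T.spec ∧ z ∈ T.pointSpec ∧
    FiniteDimensional ℂ (⨆ k, T.genEigenspace z k : Submodule ℂ K)}

/-- The spectrum is purely discrete. -/
def LinearPMap.HasPurelyDiscreteSpec (T : K →ₗ.[ℂ] K) : Prop := T.spec = T.discSpec

variable {V W : Type*} [AddCommGroup V] [Module ℂ V] [AddCommGroup W] [Module ℂ W]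

/-- The graph of the operator associated with a sesquilinear form, see `formOperator`. -/
def formGraph (J : V →ₗ[ℂ] K) (J' : W →ₗ[ℂ] K) (t : W →ₗ⋆[ℂ] V →ₗ[ℂ] ℂ) :
    Submodule ℂ (K × K) where
  carrier := {p | ∃ u : V, J u = p.1 ∧ ∀ v : W, t v u = inner ℂ (J' v) p.2}
  zero_mem' := ⟨0, by simp, fun v => by simp⟩
  add_mem' := by
    rintro p q ⟨u, hu, hu'⟩ ⟨v, hv, hv'⟩
    exact ⟨u + v, by simp [hu, hv], fun w => by simp [hu', hv']⟩
  smul_mem' := by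
    rintro c p ⟨u, hu, hu'⟩
    exact ⟨c • u, by simp [hu], fun w => by simp [hu']⟩

/-- The operator `T` in `K` associated with a sesquilinear form `t`, where `V` (the space of
trial vectors) and `W` (the space of test vectors) are mapped into `K` by `J` and `J'`:
`J u ∈ dom T` and `T (J u) = g` iff `t v u = ⟪J' v, g⟫` for all `v ∈ W`.
It is well-defined if `J` is injective and `J'` has dense range, see `formOperator_graph`.
Sesquilinear forms and inner products are antilinear in the first and linear in the second
argument, so the trial vector stands in the second argument. -/
def formOperator (J : V →ₗ[ℂ] K) (J' : W →ₗ[ℂ] K) (t : W →ₗ⋆[ℂ] V →ₗ[ℂ] ℂ) : K →ₗ.[ℂ] K :=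
  (formGraph J J' t).toLinearPMap

theorem formOperator_graph (J : V →ₗ[ℂ] K) (J' : W →ₗ[ℂ] K) (t : W →ₗ⋆[ℂ] V →ₗ[ℂ] ℂ)
    (hJ : Function.Injective J) (hJ' : DenseRange J') :
    (formOperator J J' t).graph = formGraph J J' t := by
  refine Submodule.toLinearPMap_graph_eq _ ?_
  rintro ⟨x, y⟩ ⟨u, hu, hu'⟩ hx
  simp only at hu hu' hx
  have h0 : u = 0 := hJ (by rw [hu, hx, map_zero])
  subst h0
  refine hJ'.eq_zero_of_inner_right (𝕜 := ℂ) ?_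
  intro v
  rw [← hu' v, map_zero]

end Operators

/-! ### Non-negative quadratic forms -/

/-- A non-negative quadratic form in `H`, given through its sesquilinear form
(antilinear in the first argument) on the domain `dom`. -/
structure NonnegForm (H : Type*) [NormedAddCommGroup H] [InnerProductSpace ℂ H] where
  dom : Submodule ℂ H
  form : dom →ₗ⋆[ℂ] dom →ₗ[ℂ] ℂ
  conj_symm : ∀ u v, conj (form v u) = form u v
  nonneg : ∀ u, 0 ≤ (form u u).re

namespace NonnegForm

variable {H : Type*} [NormedAddCommGroup H] [InnerProductSpace ℂ H] (h : NonnegForm H)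

/-- The form domain `H¹`: the vector space `h.dom`, to be endowed with the form norm
`‖u‖₁² = ‖u‖² + h(u)` instead of the norm of `H`. -/
def Dom : Type _ := h.dom

instance : AddCommGroup h.Dom := inferInstanceAs (AddCommGroup h.dom)

instance : Module ℂ h.Dom := inferInstanceAs (Module ℂ h.dom)

/-- The inclusion of the form domain into `H`. -/
def incl : h.Dom →ₗ[ℂ] H := h.dom.subtype

/-- The form, as a sesquilinear form on the form domain. -/
def sesq : h.Dom →ₗ⋆[ℂ] h.Dom →ₗ[ℂ] ℂ := h.form

/-- The inner product `⟪u, v⟫₁ = ⟪u, v⟫ + h(u, v)` of the form domain. -/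
@[reducible]
def innerCore : InnerProductSpace.Core ℂ h.Dom where
  inner u v := inner ℂ (h.incl u) (h.incl v) + h.sesq u v
  conj_inner_symm u v := by
    have h1 : conj (h.sesq v u) = h.sesq u v := h.conj_symm u v
    simp [h1]
  re_inner_nonneg u := by
    have h1 : 0 ≤ (h.sesq u u).re := h.nonneg u
    have h2 : 0 ≤ (inner ℂ (h.incl u) (h.incl u)).re := inner_self_nonneg (𝕜 := ℂ)
    simpa using add_nonneg h2 h1
  add_left u v w := by
    simp only [map_add, inner_add_left, LinearMap.add_apply]; ring
  smul_left u v c := by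
    simp only [map_smul, inner_smul_left, LinearMap.map_smulₛₗ, LinearMap.smul_apply,
      smul_eq_mul]; ring
  definite u hu := by
    have h1 : 0 ≤ (h.sesq u u).re := h.nonneg u
    have h2 : 0 ≤ (inner ℂ (h.incl u) (h.incl u)).re := inner_self_nonneg (𝕜 := ℂ)
    have h3 : (inner ℂ (h.incl u) (h.incl u)).re + (h.sesq u u).re = 0 := by
      simpa using congrArg Complex.re hu
    have h4 : (inner ℂ (h.incl u) (h.incl u)).re = 0 := by linarith
    have h5 : h.incl u = 0 := re_inner_self_nonpos (𝕜 := ℂ) |>.1 h4.le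
    exact Subtype.ext h5

instance : NormedAddCommGroup h.Dom := h.innerCore.toNormedAddCommGroup

instance : InnerProductSpace ℂ h.Dom := InnerProductSpace.ofCore h.innerCore.toCore

theorem norm_sq_eq (u : h.Dom) : ‖u‖ ^ 2 = ‖h.incl u‖ ^ 2 + (h.sesq u u).re := by
  have h1 : inner ℂ u u = inner ℂ (h.incl u) (h.incl u) + h.sesq u u := rfl
  rw [← inner_self_eq_norm_sq (𝕜 := ℂ) u, ← inner_self_eq_norm_sq (𝕜 := ℂ) (h.incl u), h1]
  simp

/-- The sesquilinear form `h - z` on the form domain. -/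
def shift (z : ℂ) : h.Dom →ₗ⋆[ℂ] h.Dom →ₗ[ℂ] ℂ :=
  h.sesq - z • ((innerₛₗ ℂ).comp h.incl).compl₂ h.incl

theorem shift_apply (z : ℂ) (v u : h.Dom) :
    h.shift z v u = h.sesq v u - z * inner ℂ (h.incl v) (h.incl u) := by
  simp [shift]

end NonnegForm

/-! ### Boundary pairs -/

/-- A boundary pair `(Γ, G)` associated with a closed, densely defined, non-negative quadratic
form in `H`; the form is closed iff its domain is complete for the form norm. It is not required
that `ker Γ` is dense in `H`, i.e. the boundary space may be small or large in `H`. -/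
structure BoundaryPair (H G : Type*) [NormedAddCommGroup H] [InnerProductSpace ℂ H]
    [NormedAddCommGroup G] [InnerProductSpace ℂ G] where
  h : NonnegForm H
  dense_dom : Dense (h.dom : Set H)
  closed : CompleteSpace h.Dom
  Γ : h.Dom →L[ℂ] G
  denseRange : DenseRange Γ

namespace BoundaryPair

variable {H G : Type*} [NormedAddCommGroup H] [InnerProductSpace ℂ H]
  [NormedAddCommGroup G] [InnerProductSpace ℂ G] (P : BoundaryPair H G)

instance : CompleteSpace P.h.Dom := P.closed

/-- The Neumann operator: the operator in `H` associated with the form. -/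
def neumann : H →ₗ.[ℂ] H := formOperator P.h.incl P.h.incl P.h.sesq

/-- The kernel of the boundary map, a closed subspace of the form domain. -/
def kerΓ : Submodule ℂ P.h.Dom := P.Γ.ker

/-- The closure of the kernel of the boundary map in `H`. -/
def dirichletSpace : Submodule ℂ H := (P.kerΓ.map P.h.incl).topologicalClosure

/-- The inclusion of the kernel of the boundary map into its closure in `H`. -/
def dirichletIncl : P.kerΓ →ₗ[ℂ] P.dirichletSpace :=
  (P.h.incl.comp P.kerΓ.subtype).codRestrict P.dirichletSpace fun u =>
    Submodule.le_topologicalClosure _ (Submodule.mem_map_of_mem u.2)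

/-- The Dirichlet operator: the operator in the closure of `ker Γ` in `H` associated with the
restriction of the form to `ker Γ`. -/
def dirichlet : P.dirichletSpace →ₗ.[ℂ] P.dirichletSpace :=
  formOperator P.dirichletIncl P.dirichletIncl
    ((P.h.sesq.comp P.kerΓ.subtype).compl₂ P.kerΓ.subtype)

/-- The space `G^{1/2} = ran Γ`, to be endowed with the norm `‖φ‖_{1/2} = ‖S φ‖₁` instead of the
norm of `G`. -/
def Half : Type _ := P.Γ.range

instance : AddCommGroup P.Half := inferInstanceAs (AddCommGroup P.Γ.range)

instance : Module ℂ P.Half := inferInstanceAs (Module ℂ P.Γ.range)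

/-- The inclusion of `G^{1/2}` into `G`. -/
def halfIncl : P.Half →ₗ[ℂ] G := P.Γ.range.subtype

/-- The boundary map as a map onto `G^{1/2}`. -/
def bdry : P.h.Dom →ₗ[ℂ] P.Half := P.Γ.toLinearMap.rangeRestrict

theorem halfIncl_bdry (u : P.h.Dom) : P.halfIncl (P.bdry u) = P.Γ u := rfl

theorem bdry_bijective : Function.Bijective (P.bdry.comp P.kerΓᗮ.subtype) := by
  have hc : IsClosed (P.kerΓ : Set P.h.Dom) := P.Γ.isClosed_ker
  have : CompleteSpace P.kerΓ := hc.completeSpace_coe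
  constructor
  · rw [← LinearMap.ker_eq_bot, LinearMap.ker_eq_bot']
    intro u hu
    have h1 : (u : P.h.Dom) ∈ P.kerΓ := congrArg P.halfIncl hu
    have h2 : (u : P.h.Dom) ∈ P.kerΓ ⊓ P.kerΓᗮ := ⟨h1, u.2⟩
    rw [Submodule.inf_orthogonal_eq_bot] at h2
    exact Subtype.ext h2
  · rintro ⟨φ, u, rfl⟩
    obtain ⟨v, hv, w, hw, rfl⟩ := P.kerΓ.exists_add_mem_mem_orthogonal u
    refine ⟨⟨w, hw⟩, Subtype.ext ?_⟩
    have h1 : P.Γ v = 0 := hv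
    change P.Γ w = P.Γ (v + w)
    rw [map_add, h1, zero_add]

/-- The Dirichlet solution operator `S` at the point `-1`: the inverse of the restriction of `Γ`
to the orthogonal complement of `ker Γ` in the form domain. -/
def S₀ : P.Half →ₗ[ℂ] P.h.Dom :=
  P.kerΓᗮ.subtype.comp (LinearEquiv.ofBijective _ P.bdry_bijective).symm.toLinearMap

theorem S₀_injective : Function.Injective P.S₀ :=
  Subtype.val_injective.comp (LinearEquiv.ofBijective _ P.bdry_bijective).symm.injective

instance : NormedAddCommGroup P.Half := NormedAddCommGroup.induced P.Half P.h.Dom P.S₀ P.S₀_injective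

instance : NormedSpace ℂ P.Half := NormedSpace.induced ℂ P.Half P.h.Dom P.S₀

theorem norm_half (φ : P.Half) : ‖φ‖ = ‖P.S₀ φ‖ := rfl

/-- The space `L¹(z)` of weak solutions at the point `z`. -/
def weakSol (z : ℂ) : Submodule ℂ P.h.Dom where
  carrier := {u | ∀ f ∈ P.kerΓ, P.h.shift z f u = 0}
  zero_mem' := fun f _ => map_zero _
  add_mem' := fun hu hv f hf => by rw [map_add, hu f hf, hv f hf, add_zero]
  smul_mem' := fun c u hu f hf => by rw [map_smul, hu f hf, smul_zero]

/-- The Dirichlet solution operator `S(z)`: the inverse of the restriction of `Γ` to `L¹(z)`, as a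
map from `G^{1/2}` to the form domain. If `z` is not in the spectrum of the Dirichlet operator,
then the restriction is bijective, i.e. the domain of `S(z)` is all of `G^{1/2}`. -/
def S (z : ℂ) : P.Half →ₗ.[ℂ] P.h.Dom :=
  (LinearPMap.mk (P.weakSol z) (P.bdry.comp (P.weakSol z).subtype)).inverse

/-- The Dirichlet-to-Neumann form: `(φ, ψ) ↦ (h - z)(S(z) φ, S ψ)`, where `φ` is the second and
`ψ` is the first (antilinear) argument in the order that is used here. -/
def dtnForm (z : ℂ) : P.Half →ₗ⋆[ℂ] (P.S z).domain →ₗ[ℂ] ℂ :=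
  ((P.h.shift z).comp P.S₀).compl₂ (P.S z).toFun

/-- The (strong) Dirichlet-to-Neumann operator `Λ(z)`: the operator in `G` associated with the
Dirichlet-to-Neumann form. -/
def dtn (z : ℂ) : G →ₗ.[ℂ] G :=
  formOperator (P.halfIncl.comp (P.S z).domain.subtype) P.halfIncl (P.dtnForm z)

/-- The kernel of `Λ(z)`, as a subspace of `G^{1/2}` (which contains the domain of `Λ(z)`). -/
def kerDtn (z : ℂ) : Submodule ℂ P.Half := ((P.dtn z).eigenspace 0).comap P.halfIncl

/-- The kernel of the Neumann operator minus `z`, as a subspace of the form domain (which contains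
the domain of the Neumann operator). -/
def kerNeumann (z : ℂ) : Submodule ℂ P.h.Dom := (P.neumann.eigenspace z).comap P.h.incl

end BoundaryPair

end

/-!
The form domain `V = H¹` with the form norm is a Hilbert space on which every object of the theorem
becomes a bounded operator. Let `J : V → H` be the inclusion and `A = J† J` (`gram`). Then
`(h - z)(f, u) = ⟪f, M(z) u⟫` with `M(z) = 1 - (1 + z) A` (`shiftOp`), and three operators are
described in the same way, by pairs `(γ, L)` such that `T (γ u) = y` means `L u = γ† y`
(`LinearPMap.IsRepresentedBy`): the Neumann operator with `γ = J` and `L = 1 - A`, the Dirichlet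
operator with the restriction of `J` to `ker Γ`, and, if `z` is not in the Dirichlet spectrum, the
operator `Λ(z)` with `γ = Γ` and `L = M(z)` (`isRepresentedBy_dtn`). For the last one, testing with
all `f ∈ V` and not just with `f = S ψ` forces `u` to be a weak solution. If `L - ζ γ† γ` is
invertible, the resolvent of `T` at `ζ` is `γ (L - ζ γ† γ)⁻¹ γ†`; for the Neumann and the Dirichlet
operator, invertibility is also necessary.

(i) Both `ker (H^N - l)` and `ker Λ(l)` are images of `ker M(l)`, under `J` and `Γ`. The norms are
compared by the a priori bound `exists_norm_le_of_mem_weakSol` for weak solutions.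

(ii) An operator with a compact resolvent has purely discrete spectrum
(`LinearPMap.IsResolvent.hasPurelyDiscreteSpec`), by the Fredholm alternative and Riesz' argument
with chains of subspaces, `IsCompactOperator.false_of_chain`. If the Neumann resolvent at `-1`, which
is `J J†`, is compact, then so is `J`, hence so is the Dirichlet resolvent. The operator `Λ(l)` has
a compact resolvent at `ζ = i` or `ζ = -i`: `M(l) - ζ Γ† Γ` is a compact perturbation of the identity,
and it is injective because the imaginary parts of `-l` and `-ζ` do not have opposite signs.
All three kinds of spectrum then coincide with the point spectrum, and (i) applies.

(iii) One has `Λ(z)⁻¹ = Γ M(z)⁻¹ Γ†`, and `M(z)⁻¹` is normal, so its norm is its spectral radius,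
the supremum of `|1 + μ| / |μ - z|` over the Neumann spectrum, up to the possible spectral value `1`.
Close to an isolated point `l` this is at most `(1 + |l|) / |z - l|`
(`eventually_norm_inverse_le`).
-/

/-! ### Compact operators -/

section Compact

variable {X Y : Type*} [NormedAddCommGroup X] [NormedAddCommGroup Y]

open scoped InnerProduct in
/-- If `S† S` is compact, then so is `S`, because `‖S x‖² ≤ ‖S† S x‖ ‖x‖`. -/
theorem IsCompactOperator.of_adjoint_comp_self [InnerProductSpace ℂ X] [InnerProductSpace ℂ Y]
    [CompleteSpace X] [CompleteSpace Y] {S : X →L[ℂ] Y} (h : IsCompactOperator (S† ∘L S)) :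
    IsCompactOperator S := by
  have key : ∀ x y : X, ‖x‖ ≤ 1 → ‖y‖ ≤ 1 → ‖S x - S y‖ ^ 2 ≤ ‖(S† ∘L S) x - (S† ∘L S) y‖ * 2 := by
    intro x y hx hy
    have h1 : ‖S (x - y)‖ ^ 2 = (inner ℂ ((S† ∘L S) (x - y)) (x - y) : ℂ).re :=
      ContinuousLinearMap.apply_norm_sq_eq_inner_adjoint_left S (x - y)
    rw [← map_sub, ← map_sub, h1]
    refine (Complex.re_le_norm _).trans ((norm_inner_le_norm _ _).trans ?_)
    gcongr
    exact (norm_sub_le x y).trans (by linarith)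
  refine (isCompactOperator_iff_isCompact_closure_image_closedBall S.toLinearMap one_pos).2 ?_
  have hT : TotallyBounded ((S† ∘L S) '' Metric.closedBall 0 1) :=
    (IsCompactOperator.isCompact_closure_image_closedBall (f := (S† ∘L S).toLinearMap) h 1).totallyBounded.subset
      subset_closure
  refine (TotallyBounded.closure ?_).isCompact_of_isClosed isClosed_closure
  rw [Metric.totallyBounded_iff]
  intro ε hε
  -- Centres of a finite net are moved into the image at the cost of a factor `2` in the radius.
  obtain ⟨t, ht, hcov⟩ := totallyBounded_iff_subset.1 hT _
    (Metric.dist_mem_uniformity (show 0 < ε ^ 2 / 4 by positivity))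
  obtain ⟨hfin, hcov⟩ := hcov
  have ht' : ∀ y : X, ∃ x, y ∈ t → x ∈ Metric.closedBall 0 1 ∧ (S† ∘L S) x = y := fun y => by
    by_cases hy : y ∈ t
    · obtain ⟨x, hx, hxy⟩ := ht hy
      exact ⟨x, fun _ => ⟨hx, hxy⟩⟩
    · exact ⟨0, fun h => absurd h hy⟩
  choose g hg using ht'
  refine ⟨(fun y => S (g y)) '' t, hfin.image _, ?_⟩
  rintro _ ⟨x, hx, rfl⟩
  obtain ⟨y, hy, hxy⟩ := Set.mem_iUnion₂.1 (hcov ⟨x, hx, rfl⟩)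
  refine Set.mem_iUnion₂.2 ⟨S (g y), ⟨y, hy, rfl⟩, ?_⟩
  have h1 := key x (g y) (by simpa using hx) (by simpa using (hg y hy).1)
  have h2 : ‖(S† ∘L S) x - (S† ∘L S) (g y)‖ < ε ^ 2 / 4 := by
    rw [(hg y hy).2, ← dist_eq_norm]; exact hxy
  rw [Metric.mem_ball, dist_eq_norm]
  change ‖S x - S (g y)‖ < ε
  nlinarith [norm_nonneg (S x - S (g y))]

variable [NormedSpace ℂ X] {C : X →L[ℂ] X}

/-- A compact operator `C` admits no strictly increasing sequence of closed subspaces `E n` such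
that `C - μ n` maps `E (n + 1)` into `E n`, if the `μ n` stay away from zero: the images under `C` of
almost orthogonal unit vectors `x n ∈ E (n + 1)` would have no Cauchy subsequence. -/
theorem IsCompactOperator.false_of_chain (hC : IsCompactOperator C) {E : ℕ → Submodule ℂ X}
    (hcl : ∀ n, IsClosed (E n : Set X)) (hE : ∀ n, E n < E (n + 1)) {μ : ℕ → ℂ} {δ : ℝ} (hδ : 0 < δ)
    (hμ : ∀ n, δ ≤ ‖μ n‖) (hCE : ∀ n, ∀ x ∈ E (n + 1), C x - μ n • x ∈ E n) : False := by
  have hmono : Monotone E := monotone_nat_of_le_succ fun n => (hE n).le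
  have hx : ∀ n, ∃ x ∈ E (n + 1), ‖x‖ = 1 ∧ ∀ y ∈ E n, 1 / 2 ≤ ‖x - y‖ := by
    intro n
    have h1 : IsClosed ((E n).comap (E (n + 1)).subtype : Set (E (n + 1))) :=
      (hcl n).preimage continuous_subtype_val
    obtain ⟨x, hx, hx'⟩ := SetLike.exists_of_lt (hE n)
    obtain ⟨⟨x, hx⟩, -, hx1, hx2⟩ := riesz_lemma_of_lt_one (𝕜 := ℂ) h1 ⟨⟨x, hx⟩, hx'⟩
      (show (1 / 2 : ℝ) < 1 by norm_num)
    exact ⟨x, hx, hx1, fun y hy => hx2 ⟨y, hmono n.le_succ hy⟩ hy⟩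
  choose x hxE hx1 hxd using hx
  have hsep : ∀ m n, m < n → δ / 2 ≤ ‖C (x n) - C (x m)‖ := by
    intro m n hmn
    have hμ0 : μ n ≠ 0 := norm_pos_iff.1 (hδ.trans_le (hμ n))
    have h1 : C (x m) ∈ E n := by
      have h2 := (E (m + 1)).add_mem (hmono m.le_succ (hCE m _ (hxE m)))
        ((E (m + 1)).smul_mem (μ m) (hxE m))
      rw [sub_add_cancel] at h2
      exact hmono hmn h2
    have h2 := hxd n _ ((E n).smul_mem (μ n)⁻¹ ((E n).sub_mem h1 (hCE n _ (hxE n))))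
    have h3 : C (x n) - C (x m) =
        μ n • (x n - (μ n)⁻¹ • (C (x m) - (C (x n) - μ n • x n))) := by
      rw [smul_sub, smul_inv_smul₀ hμ0]; abel
    rw [h3, norm_smul]
    nlinarith [hμ n]
  obtain ⟨S, hS, hS'⟩ := IsCompactOperator.image_closedBall_subset_compact
    (f := C.toLinearMap) hC 1
  obtain ⟨y, -, ψ, hψ, hψy⟩ := hS.tendsto_subseq
    (x := fun n => C (x n)) (fun n => hS' ⟨x n, by simp [hx1], rfl⟩)
  obtain ⟨N, hN⟩ := Metric.cauchySeq_iff'.1 hψy.cauchySeq (δ / 2) (by positivity)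
  have h1 := hN (N + 1) N.le_succ
  rw [dist_eq_norm] at h1
  exact absurd (hsep _ _ (hψ N.lt_succ_self)) (not_le.2 h1)

/-- A compact operator has no sequence of distinct eigenvalues that stays away from zero. -/
theorem IsCompactOperator.false_of_injective_eigenvalues (hC : IsCompactOperator C) {μ : ℕ → ℂ}
    (hinj : Function.Injective μ) {δ : ℝ} (hδ : 0 < δ) (hμ : ∀ n, δ ≤ ‖μ n‖) {x : ℕ → X}
    (hx0 : ∀ n, x n ≠ 0) (hx : ∀ n, C (x n) = μ n • x n) : False := by
  have hli : LinearIndependent ℂ x :=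
    Module.End.eigenvectors_linearIndependent' C.toLinearMap μ hinj x fun n =>
      Module.End.hasEigenvector_iff.2 ⟨Module.End.mem_eigenspace_iff.2 (hx n), hx0 n⟩
  refine hC.false_of_chain (E := fun n => Submodule.span ℂ (x '' Set.Iio n)) (μ := μ)
    (fun n => ?_) (fun n => ?_) hδ hμ (fun n y hy => ?_)
  · have := FiniteDimensional.span_of_finite ℂ ((Set.finite_Iio n).image x)
    exact Submodule.closed_of_finiteDimensional _
  · refine lt_of_le_of_ne (Submodule.span_mono (Set.image_mono (Set.Iio_subset_Iio n.le_succ)))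
      fun h => hli.notMem_span_image (s := Set.Iio n) (x := n) (by simp) ?_
    rw [h]
    exact Submodule.subset_span ⟨n, by simp, rfl⟩
  · have hle : Submodule.span ℂ (x '' Set.Iio (n + 1)) ≤
        (Submodule.span ℂ (x '' Set.Iio n)).comap (C.toLinearMap - μ n • LinearMap.id) := by
      refine Submodule.span_le.2 ?_
      rintro _ ⟨m, hm, rfl⟩
      have h1 : (C.toLinearMap - μ n • LinearMap.id : X →ₗ[ℂ] X) (x m) = (μ m - μ n) • x m := by
        simp [hx, sub_smul]
      rw [SetLike.mem_coe, Submodule.mem_comap, h1]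
      rcases (Nat.lt_succ_iff.1 hm).eq_or_lt with rfl | hlt
      · simp
      · exact Submodule.smul_mem _ _ (Submodule.subset_span ⟨m, hlt, rfl⟩)
    exact hle hy

/-- Riesz: the generalized eigenspace of a compact operator for a nonzero eigenvalue, here any
sum of subspaces `N k` with `N 0 = ⊥` and `(C - μ) N (k + 1) ⊆ N k`, has finite
dimension. -/
theorem IsCompactOperator.finiteDimensional_iSup (hC : IsCompactOperator C) {μ : ℂ} (hμ : μ ≠ 0)
    {N : ℕ → Submodule ℂ X} (hN0 : N 0 = ⊥)
    (hCN : ∀ k, ∀ x ∈ N (k + 1), C x - μ • x ∈ N k) :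
    FiniteDimensional ℂ (⨆ k, N k : Submodule ℂ X) := by
  by_contra hinf
  -- A subspace of finite dimension can be enlarged by one vector `x` that `C - μ` maps into it:
  -- an element of the first `N k` that it does not contain.
  have step : ∀ F : Submodule ℂ X, FiniteDimensional ℂ F →
      ∃ x, x ∉ F ∧ C x - μ • x ∈ F := by
    intro F hF
    have h1 : ∃ k, ¬ N k ≤ F := by
      by_contra! h2
      exact hinf (Submodule.finiteDimensional_of_le (iSup_le h2))
    classical
    obtain ⟨x, hxN, hxF⟩ := SetLike.not_le_iff_exists.1 (Nat.find_spec h1)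
    rcases hk : Nat.find h1 with _ | k
    · rw [hk, hN0, Submodule.mem_bot] at hxN
      exact absurd (hxN ▸ F.zero_mem) hxF
    · rw [hk] at hxN
      refine ⟨x, hxF, ?_⟩
      have h2 : N k ≤ F := not_not.1 (Nat.find_min h1 (m := k) (by omega))
      exact h2 (hCN k x hxN)
  let I := {F : Submodule ℂ X // FiniteDimensional ℂ F ∧ ∀ x ∈ F, C x - μ • x ∈ F}
  have step' : ∀ F : I, ∃ F' : I, F.1 < F'.1 ∧ ∀ x ∈ F'.1, C x - μ • x ∈ F.1 := by
    rintro ⟨F, hF, hFC⟩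
    obtain ⟨x, hxF, hx⟩ := step F hF
    have h1 : ∀ y ∈ F ⊔ ℂ ∙ x, C y - μ • y ∈ F := by
      intro y hy
      obtain ⟨f, hf, w, hw, rfl⟩ := Submodule.mem_sup.1 hy
      obtain ⟨c, rfl⟩ := Submodule.mem_span_singleton.1 hw
      have h2 : C (f + c • x) - μ • (f + c • x) = (C f - μ • f) + c • (C x - μ • x) := by
        rw [map_add, map_smul]; module
      rw [h2]
      exact F.add_mem (hFC f hf) (F.smul_mem c hx)
    refine ⟨⟨F ⊔ ℂ ∙ x, inferInstance, fun y hy => (le_sup_left : F ≤ F ⊔ ℂ ∙ x) (h1 y hy)⟩,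
      lt_of_le_of_ne le_sup_left fun h => hxF ?_, h1⟩
    change F = F ⊔ ℂ ∙ x at h
    rw [h]
    exact (le_sup_right : ℂ ∙ x ≤ F ⊔ ℂ ∙ x) (Submodule.mem_span_singleton_self x)
  choose next hlt hnext using step'
  let F : ℕ → I := fun n => Nat.rec ⟨⊥, inferInstance, by simp⟩ (fun _ G => next G) n
  refine hC.false_of_chain (E := fun n => (F n).1) (μ := fun _ => μ) (fun n => ?_)
    (fun n => hlt (F n)) (norm_pos_iff.2 hμ) (fun _ => le_rfl) (fun n => hnext (F n))
  have := (F n).2.1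
  exact Submodule.closed_of_finiteDimensional _

end Compact

/-! ### Operators with a compact resolvent -/

namespace LinearPMap

variable {K : Type*} [NormedAddCommGroup K] [InnerProductSpace ℂ K] {T : K →ₗ.[ℂ] K}

theorem mem_shiftComap {z : ℂ} {W : Submodule ℂ K} {x : K} :
    x ∈ T.shiftComap z W ↔ ∃ y, (x, y) ∈ T.graph ∧ y - z • x ∈ W := by
  constructor
  · rintro ⟨hx, h⟩
    exact ⟨_, T.mem_graph ⟨x, hx⟩, h⟩
  · rintro ⟨y, hy, h⟩
    obtain ⟨x, rfl, rfl⟩ := T.mem_graph_iff.1 hy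
    exact ⟨x.2, h⟩

theorem mem_eigenspace {z : ℂ} {x : K} : x ∈ T.eigenspace z ↔ (x, z • x) ∈ T.graph := by
  rw [eigenspace, mem_shiftComap]
  constructor
  · rintro ⟨y, hy, h⟩
    rw [Submodule.mem_bot, sub_eq_zero] at h
    exact h ▸ hy
  · exact fun h => ⟨_, h, by simp⟩

theorem isResolvent_iff {z : ℂ} {B : K →L[ℂ] K} : T.IsResolvent z B ↔
    (∀ x y, (x, y) ∈ T.graph → B (y - z • x) = x) ∧ ∀ y, (B y, y + z • B y) ∈ T.graph := by
  constructor
  · rintro ⟨h1, h2⟩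
    refine ⟨fun x y hxy => ?_, fun y => ?_⟩
    · obtain ⟨x, rfl, rfl⟩ := T.mem_graph_iff.1 hxy
      exact h1 x
    · obtain ⟨hy, h⟩ := h2 y
      exact T.mem_graph_iff.2 ⟨⟨_, hy⟩, rfl, eq_add_of_sub_eq h⟩
  · rintro ⟨h1, h2⟩
    refine ⟨fun x => h1 _ _ (T.mem_graph x), fun y => ?_⟩
    obtain ⟨x, hx, hx'⟩ := T.mem_graph_iff.1 (h2 y)
    have hm : B y ∈ T.domain := by
      change (x : K) = B y at hx
      exact hx ▸ x.2
    have h3 : x = ⟨B y, hm⟩ := Subtype.ext hx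
    exact ⟨hm, by rw [← h3, hx', add_sub_cancel_right]⟩

theorem IsResolvent.unique {z : ℂ} {B B' : K →L[ℂ] K} (h : T.IsResolvent z B)
    (h' : T.IsResolvent z B') : B = B' := by
  ext y
  have h1 := (isResolvent_iff.1 h).1 _ _ ((isResolvent_iff.1 h').2 y)
  rwa [add_sub_cancel_right] at h1

theorem pointSpec_subset_spec : T.pointSpec ⊆ T.spec := by
  rintro z hz ⟨B, hB⟩
  refine hz ((Submodule.eq_bot_iff _).2 fun x hx => ?_)
  have h1 := (isResolvent_iff.1 hB).1 _ _ (mem_eigenspace.1 hx)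
  rw [sub_self, _root_.map_zero] at h1
  exact h1.symm

theorem discSpec_subset_spec : T.discSpec ⊆ T.spec := fun _ h => h.1.1

theorem HasPurelyDiscreteSpec.discSpec_eq (h : T.HasPurelyDiscreteSpec) :
    T.discSpec = T.pointSpec :=
  Set.Subset.antisymm (fun _ hz => hz.2.1) (pointSpec_subset_spec.trans h.le)

variable {z₀ : ℂ} {B : K →L[ℂ] K}

/-- Eigenvectors of `T` at `w` are eigenvectors of the resolvent at `z₀` for `(w - z₀)⁻¹`. -/
theorem IsResolvent.apply_eigenvector (hB : T.IsResolvent z₀ B) {w : ℂ} (hw : w ≠ z₀) {x : K}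
    (hx : x ∈ T.eigenspace w) : B x = (w - z₀)⁻¹ • x := by
  have h1 := (isResolvent_iff.1 hB).1 _ _ (mem_eigenspace.1 hx)
  rw [← sub_smul, _root_.map_smul] at h1
  rw [eq_inv_smul_iff₀ (sub_ne_zero.2 hw), h1]

theorem IsResolvent.mem_eigenspace_of_apply (hB : T.IsResolvent z₀ B) {w : ℂ} (hw : w ≠ z₀) {x : K}
    (hx : B x = (w - z₀)⁻¹ • x) : x ∈ T.eigenspace w := by
  have h1 := T.graph.smul_mem (w - z₀) ((isResolvent_iff.1 hB).2 x)
  rw [hx, Prod.smul_mk, smul_add, smul_comm _ z₀, smul_inv_smul₀ (sub_ne_zero.2 hw),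
    ← add_smul, sub_add_cancel] at h1
  exact mem_eigenspace.2 h1

/-- On `ker (T - w) ^ (k + 1)` the resolvent at `z₀` acts as `(w - z₀)⁻¹` up to an element of
`ker (T - w) ^ k`. -/
theorem IsResolvent.apply_genEigenvector (hB : T.IsResolvent z₀ B) {w : ℂ} (hw : w ≠ z₀) (k : ℕ) :
    ∀ x ∈ T.genEigenspace w (k + 1), B x - (w - z₀)⁻¹ • x ∈ T.genEigenspace w k := by
  have hw' : w - z₀ ≠ 0 := sub_ne_zero.2 hw
  have hformula : ∀ x y, (x, y) ∈ T.graph → B (y - w • x) = x - (w - z₀) • B x := by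
    intro x y hxy
    have h1 := (isResolvent_iff.1 hB).1 _ _ hxy
    have h2 : y - w • x = (y - z₀ • x) - (w - z₀) • x := by module
    rw [h2, _root_.map_sub, h1, _root_.map_smul]
  have hinv : ∀ k, ∀ x ∈ T.genEigenspace w k, B x ∈ T.genEigenspace w k := by
    intro k
    induction k with
    | zero =>
      intro x hx
      have h1 : x = 0 := hx
      rw [h1, _root_.map_zero]
      exact Submodule.zero_mem _
    | succ k ih =>
      intro x hx
      obtain ⟨y, hy, h⟩ := mem_shiftComap.1 hx
      refine mem_shiftComap.2 ⟨_, (isResolvent_iff.1 hB).2 x, ?_⟩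
      have h1 := ih _ h
      rw [hformula x y hy] at h1
      convert h1 using 1
      module
  intro x hx
  obtain ⟨y, hy, h⟩ := mem_shiftComap.1 hx
  have h1 := (T.genEigenspace w k).smul_mem (-(w - z₀)⁻¹) (hinv k _ h)
  rw [hformula x y hy, smul_sub, neg_smul, neg_smul, inv_smul_smul₀ hw', sub_neg_eq_add,
    neg_add_eq_sub] at h1
  exact h1

/-- Every point of the spectrum of an operator with a compact resolvent is an eigenvalue, by the
Fredholm alternative for the resolvent. -/
theorem IsResolvent.spec_subset_pointSpec [CompleteSpace K] (hB : T.IsResolvent z₀ B)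
    (hc : IsCompactOperator B) : T.spec ⊆ T.pointSpec := by
  intro z hz
  have hne : z ≠ z₀ := by
    rintro rfl
    exact hz ⟨B, hB⟩
  have hne' : z - z₀ ≠ 0 := sub_ne_zero.2 hne
  rcases hc.hasEigenvalue_or_mem_resolventSet (inv_ne_zero hne') with h | h
  · obtain ⟨x, hx⟩ := h.exists_hasEigenvector
    have h1 : B x = (z - z₀)⁻¹ • x := hx.apply_eq_smul
    exact (Submodule.ne_bot_iff _).2 ⟨x, hB.mem_eigenspace_of_apply hne h1, hx.2⟩
  · refine absurd ?_ hz
    obtain ⟨U, hU⟩ := spectrum.mem_resolventSet_iff.1 h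
    have hU' : ∀ x, (U : K →L[ℂ] K) x = (z - z₀)⁻¹ • x - B x := by
      intro x
      rw [hU]
      simp [Algebra.algebraMap_eq_smul_one]
    have hUi : ∀ x, (U⁻¹ : (K →L[ℂ] K)ˣ).1 ((U : K →L[ℂ] K) x) = x := fun x =>
      congrArg (fun f : K →L[ℂ] K => f x) U.inv_mul
    have hiU : ∀ x, (U : K →L[ℂ] K) ((U⁻¹ : (K →L[ℂ] K)ˣ).1 x) = x := fun x =>
      congrArg (fun f : K →L[ℂ] K => f x) U.mul_inv
    have hcomm : ∀ x, (U⁻¹ : (K →L[ℂ] K)ˣ).1 (B x) = B ((U⁻¹ : (K →L[ℂ] K)ˣ).1 x) := by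
      intro x
      rw [← hUi (B ((U⁻¹ : (K →L[ℂ] K)ˣ).1 x)), hU', ← _root_.map_smul, ← _root_.map_sub, ← hU', hiU]
    -- `(T - z)⁻¹ = μ B (μ - B)⁻¹` with `μ = (z - z₀)⁻¹`
    refine ⟨(z - z₀)⁻¹ • (B ∘L (U⁻¹ : (K →L[ℂ] K)ˣ).1), isResolvent_iff.2 ⟨?_, fun y => ?_⟩⟩
    · intro x y hxy
      have h1 := (isResolvent_iff.1 hB).1 _ _ hxy
      have h2 : y - z • x = (y - z₀ • x) - (z - z₀) • x := by module
      have h3 : B (y - z • x) = (z - z₀) • (U : K →L[ℂ] K) x := by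
        rw [h2, _root_.map_sub, h1, _root_.map_smul, hU', smul_sub, smul_inv_smul₀ hne']
      change (z - z₀)⁻¹ • B ((U⁻¹ : (K →L[ℂ] K)ˣ).1 (y - z • x)) = x
      rw [← hcomm, h3, _root_.map_smul, hUi, inv_smul_smul₀ hne']
    · set v := (U⁻¹ : (K →L[ℂ] K)ˣ).1 y with hv
      have h1 := T.graph.smul_mem (z - z₀)⁻¹ ((isResolvent_iff.1 hB).2 v)
      have h2 : y = (z - z₀)⁻¹ • v - B v := by rw [← hU', hv, hiU]
      convert h1 using 1
      refine Prod.ext rfl ?_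
      change y + z • ((z - z₀)⁻¹ • B v) = (z - z₀)⁻¹ • (v + z₀ • B v)
      have h3 : B v = (z - z₀) • (z - z₀)⁻¹ • B v := (smul_inv_smul₀ hne' _).symm
      rw [h2]
      nth_rewrite 1 [h3]
      module

/-- The spectrum of an operator with a compact resolvent is purely discrete. -/
theorem IsResolvent.hasPurelyDiscreteSpec [CompleteSpace K] (hB : T.IsResolvent z₀ B)
    (hc : IsCompactOperator B) : T.HasPurelyDiscreteSpec := by
  refine Set.Subset.antisymm (fun z hz => ?_) discSpec_subset_spec
  have hne : ∀ w ∈ T.spec, w ≠ z₀ := by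
    rintro w hw rfl
    exact hw ⟨B, hB⟩
  refine ⟨⟨hz, ?_⟩, hB.spec_subset_pointSpec hc hz,
    hc.finiteDimensional_iSup (inv_ne_zero (sub_ne_zero.2 (hne z hz))) rfl
      (hB.apply_genEigenvector (hne z hz))⟩
  by_contra hacc
  have hinf : (Metric.ball z 1 ∩ T.spec).Infinite := by
    refine Set.Infinite.of_accPt (x := z) ?_
    rw [accPt_iff_frequently_nhdsNE]
    have h1 : ∃ᶠ w in 𝓝[≠] z, w ∈ T.spec := hacc
    have h2 : ∀ᶠ w in 𝓝[≠] z, w ∈ Metric.ball z 1 :=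
      nhdsWithin_le_nhds (Metric.ball_mem_nhds z one_pos)
    exact (h1.and_eventually h2).mono fun w hw => ⟨hw.2, hw.1⟩
  let w : ℕ ↪ (Metric.ball z 1 ∩ T.spec : Set ℂ) := hinf.natEmbedding
  have hx : ∀ n, ∃ x ∈ T.eigenspace (w n), x ≠ 0 := fun n =>
    (Submodule.ne_bot_iff _).1 (hB.spec_subset_pointSpec hc (w n).2.2)
  choose x hx hx0 using hx
  refine hc.false_of_injective_eigenvalues (μ := fun n => ((w n : ℂ) - z₀)⁻¹)
    (δ := (1 + ‖z - z₀‖)⁻¹) (fun m n hmn => ?_) (by positivity) (fun n => ?_) hx0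
    (fun n => hB.apply_eigenvector (hne _ (w n).2.2) (hx n))
  · exact w.injective (Subtype.ext (sub_left_inj.1 (inv_injective hmn)))
  · rw [norm_inv]
    refine inv_anti₀ (norm_pos_iff.2 (sub_ne_zero.2 (hne _ (w n).2.2))) ?_
    have h1 : ‖(w n : ℂ) - z‖ < 1 := by
      have h2 := (w n).2.1
      rwa [Metric.mem_ball, dist_eq_norm] at h2
    have h2 : (w n : ℂ) - z₀ = ((w n : ℂ) - z) + (z - z₀) := by ring
    rw [h2]
    exact (norm_add_le _ _).trans (by linarith)

end LinearPMap

/-! ### Operators represented by bounded operators on a form domain -/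

theorem one_sub_sub_smul_eq {V : Type*} [NormedAddCommGroup V] [NormedSpace ℂ V]
    (A : V →L[ℂ] V) (z : ℂ) : 1 - A - z • A = 1 - (1 + z) • A := by
  module

section Represented

open scoped InnerProduct

variable {K V : Type*} [NormedAddCommGroup K] [InnerProductSpace ℂ K] [CompleteSpace K]
  [NormedAddCommGroup V] [InnerProductSpace ℂ V] [CompleteSpace V]

/-- The operator `T` in `K` is represented by the bounded operators `γ : V → K` and `L : V → V` if
`T (γ u) = y` means `L u = γ† y`, that is, `⟪f, L u⟫ = ⟪γ f, y⟫` for all `f : V`. Here `V` is a form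
domain, `L` is the operator of a bounded sesquilinear form on `V`, and `γ` is the inclusion of `V`
or a boundary map. -/
def LinearPMap.IsRepresentedBy (T : K →ₗ.[ℂ] K) (γ : V →L[ℂ] K) (L : V →L[ℂ] V) : Prop :=
  ∀ x y, (x, y) ∈ T.graph ↔ ∃ u, γ u = x ∧ L u = (γ†) y

namespace LinearPMap.IsRepresentedBy

variable {T : K →ₗ.[ℂ] K} {γ : V →L[ℂ] K} {L : V →L[ℂ] V} {z : ℂ}

/-- The resolvent is `γ (L - z γ† γ)⁻¹ γ†`. -/
theorem isResolvent (h : T.IsRepresentedBy γ L) (U : (V →L[ℂ] V)ˣ)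
    (hU : (U : V →L[ℂ] V) = L - z • (γ† ∘L γ)) :
    T.IsResolvent z (γ ∘L ((U⁻¹ : (V →L[ℂ] V)ˣ) : V →L[ℂ] V) ∘L γ†) := by
  have hU' : ∀ u, (U : V →L[ℂ] V) u = L u - z • (γ†) (γ u) := fun u => by rw [hU]; rfl
  have hUi : ∀ u, ((U⁻¹ : (V →L[ℂ] V)ˣ) : V →L[ℂ] V) ((U : V →L[ℂ] V) u) = u := fun u =>
    congrArg (fun f : V →L[ℂ] V => f u) U.inv_mul
  have hiU : ∀ u, (U : V →L[ℂ] V) (((U⁻¹ : (V →L[ℂ] V)ˣ) : V →L[ℂ] V) u) = u := fun u =>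
    congrArg (fun f : V →L[ℂ] V => f u) U.mul_inv
  refine LinearPMap.isResolvent_iff.2 ⟨fun x y hxy => ?_, fun y => ?_⟩
  · obtain ⟨u, rfl, hu⟩ := (h x y).1 hxy
    have h1 : (γ†) (y - z • γ u) = (U : V →L[ℂ] V) u := by
      rw [_root_.map_sub, _root_.map_smul, ← hu, hU']
    change γ (((U⁻¹ : (V →L[ℂ] V)ˣ) : V →L[ℂ] V) ((γ†) (y - z • γ u))) = γ u
    rw [h1, hUi]
  · refine (h _ _).2 ⟨((U⁻¹ : (V →L[ℂ] V)ˣ) : V →L[ℂ] V) ((γ†) y), rfl, ?_⟩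
    have h1 := hiU ((γ†) y)
    rw [hU', sub_eq_iff_eq_add] at h1
    rw [h1, _root_.map_add, _root_.map_smul]
    rfl

theorem notMem_spec (h : T.IsRepresentedBy γ L) (hU : IsUnit (L - z • (γ† ∘L γ))) :
    z ∉ T.spec := by
  obtain ⟨U, hU⟩ := hU
  exact not_not.2 ⟨_, h.isResolvent U hU⟩

theorem mem_eigenspace (h : T.IsRepresentedBy γ L) {x : K} :
    x ∈ T.eigenspace z ↔ ∃ u, γ u = x ∧ (L - z • (γ† ∘L γ)) u = 0 := by
  rw [LinearPMap.mem_eigenspace, h]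
  constructor
  · rintro ⟨u, rfl, hu⟩
    refine ⟨u, rfl, ?_⟩
    rw [_root_.map_smul] at hu
    exact sub_eq_zero.2 hu
  · rintro ⟨u, rfl, hu⟩
    refine ⟨u, rfl, ?_⟩
    rw [_root_.map_smul]
    exact sub_eq_zero.1 hu

/-- Outside the spectrum `L - z γ† γ` is invertible if `L = 1 - γ† γ`: a solution of
`(L - z γ† γ) u = f` is `f + (1 + z) w`, where `w` represents the resolvent at `γ f`. -/
theorem isUnit_of_notMem_spec (h : T.IsRepresentedBy γ (1 - γ† ∘L γ))
    (hγ : Function.Injective γ) (hz : z ∉ T.spec) : IsUnit (1 - γ† ∘L γ - z • (γ† ∘L γ)) := by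
  obtain ⟨B, hB⟩ := not_not.1 hz
  refine ContinuousLinearMap.isUnit_iff_bijective.2
    ⟨(injective_iff_map_eq_zero _).2 fun u hu => ?_, fun f => ?_⟩
  · have h1 := (LinearPMap.isResolvent_iff.1 hB).1 _ _
      (LinearPMap.mem_eigenspace.1 (h.mem_eigenspace.2 ⟨u, rfl, hu⟩))
    rw [sub_self, _root_.map_zero] at h1
    exact hγ (by rw [← h1, _root_.map_zero])
  · obtain ⟨w, hw, hw'⟩ := (h _ _).1 ((LinearPMap.isResolvent_iff.1 hB).2 (γ f))
    refine ⟨f + (1 + z) • w, ?_⟩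
    change w - (γ†) (γ w) = _ at hw'
    rw [← hw, _root_.map_add, _root_.map_smul] at hw'
    change f + (1 + z) • w - (γ†) (γ (f + (1 + z) • w)) - z • (γ†) (γ (f + (1 + z) • w)) = f
    rw [_root_.map_add, _root_.map_add, _root_.map_smul, _root_.map_smul]
    have h2 : w = (γ†) (γ f) + z • (γ†) (γ w) + (γ†) (γ w) := sub_eq_iff_eq_add.1 hw'
    nth_rewrite 1 [h2]
    module

end LinearPMap.IsRepresentedBy

theorem inner_one_sub_sub_smul (J : V →L[ℂ] K) (z : ℂ) (f u : V) :
    (inner ℂ f ((1 - J† ∘L J - z • (J† ∘L J)) u) : ℂ) =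
      inner ℂ f u - (1 + z) * inner ℂ (J f) (J u) := by
  change inner ℂ f (u - (J†) (J u) - z • (J†) (J u)) = _
  rw [inner_sub_right, inner_sub_right, inner_smul_right,
    ContinuousLinearMap.adjoint_inner_right]
  ring

/-- The operator associated with a form that equals `⟪f, u⟫ - ⟪J f, J u⟫`. -/
theorem isRepresentedBy_formOperator {J : V →L[ℂ] K} (hJ : Function.Injective J)
    (hJ' : DenseRange J) {t : V →ₗ⋆[ℂ] V →ₗ[ℂ] ℂ}
    (ht : ∀ f u, t f u = inner ℂ f u - inner ℂ (J f) (J u)) :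
    (formOperator J.toLinearMap J.toLinearMap t).IsRepresentedBy J (1 - J† ∘L J) := by
  intro x y
  rw [formOperator_graph _ _ _ hJ hJ']
  refine exists_congr fun u => and_congr Iff.rfl ?_
  have h1 : ∀ f, t f u = inner ℂ f ((1 - J† ∘L J) u) := fun f => by
    rw [ht, ← ContinuousLinearMap.adjoint_inner_right, ← inner_sub_right]; rfl
  constructor
  · intro hu
    refine ext_inner_left ℂ fun f => ?_
    rw [← h1, ContinuousLinearMap.adjoint_inner_right]
    exact hu f
  · intro hu f
    rw [h1, hu, ContinuousLinearMap.adjoint_inner_right]; rfl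

theorem norm_comp_comp_adjoint_le (γ : V →L[ℂ] K) (Q : V →L[ℂ] V) :
    ‖γ ∘L Q ∘L γ†‖ ≤ ‖γ‖ ^ 2 * ‖Q‖ := by
  refine (ContinuousLinearMap.opNorm_comp_le _ _).trans ?_
  rw [pow_two, mul_assoc]
  refine mul_le_mul_of_nonneg_left ((ContinuousLinearMap.opNorm_comp_le _ _).trans ?_)
    (norm_nonneg _)
  rw [LinearIsometryEquiv.norm_map, mul_comm]

theorem isCompactOperator_comp_comp_adjoint {γ : V →L[ℂ] K} (h : IsCompactOperator γ)
    (Q : V →L[ℂ] V) : IsCompactOperator (γ ∘L Q ∘L γ†) :=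
  h.comp_clm (Q ∘L γ†)

/-- The Fredholm alternative for `1 - C` with compact `C`. -/
theorem IsCompactOperator.isUnit_one_sub {C : V →L[ℂ] V} (hC : IsCompactOperator C)
    (h : ∀ u, (1 - C) u = 0 → u = 0) : IsUnit (1 - C) := by
  rcases hC.hasEigenvalue_or_mem_resolventSet one_ne_zero with h1 | h1
  · obtain ⟨u, hu⟩ := h1.exists_hasEigenvector
    have h2 : C u = (1 : ℂ) • u := hu.apply_eq_smul
    refine absurd (h u ?_) hu.2
    change u - C u = 0
    rw [h2, one_smul, sub_self]
  · rwa [spectrum.mem_resolventSet_iff, map_one] at h1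

theorem isOpen_isUnit_one_sub_sub_smul (A : V →L[ℂ] V) :
    IsOpen {z : ℂ | IsUnit (1 - A - z • A)} := by
  have h1 : Continuous fun z : ℂ => 1 - A - z • A := by fun_prop
  exact Units.isOpen.preimage h1

/-- Resolvent estimate for the pencil `1 - (1 + z) A` with self-adjoint `A`. Let `M` be the set of
all `μ` where `1 - (1 + μ) A` is not invertible. The inverse at `z` is normal, so its norm is its
spectral radius, and its spectrum consists of the values `(1 + μ) / (μ - z)` with `μ ∈ M`, and
possibly `1`. If `l` is the only point of `M` near `l`, these are at most `(1 + |l|) / |z - l|` in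
absolute value for all `z` close to `l`. -/
theorem eventually_norm_inverse_le {A : V →L[ℂ] V} (hA : IsSelfAdjoint A) {l : ℂ}
    (hl : ∀ᶠ z in 𝓝[≠] l, IsUnit (1 - (1 + z) • A)) :
    ∀ᶠ z in 𝓝[≠] l, ∃ U : (V →L[ℂ] V)ˣ, (U : V →L[ℂ] V) = 1 - (1 + z) • A ∧
      ‖((U⁻¹ : (V →L[ℂ] V)ˣ) : V →L[ℂ] V)‖ ≤ (1 + ‖l‖) / ‖z - l‖ := by
  obtain ⟨d, hd, hball⟩ := Metric.mem_nhdsWithin_iff.1 hl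
  have hr : 0 < d / (2 * (1 + d)) := by positivity
  have hnear : ∀ᶠ z in 𝓝[≠] l, ‖z - l‖ < d / (2 * (1 + d)) := by
    filter_upwards [nhdsWithin_le_nhds (Metric.ball_mem_nhds l hr)] with z hz
    rwa [Metric.mem_ball, dist_eq_norm] at hz
  filter_upwards [hl, hnear, self_mem_nhdsWithin] with z hz hzr hzl
  have hzl' : 0 < ‖z - l‖ := norm_pos_iff.2 (sub_ne_zero.2 hzl)
  obtain ⟨U, hU⟩ := hz
  refine ⟨U, hU, ?_⟩
  have hcomm : Commute (star (U : V →L[ℂ] V)) (U : V →L[ℂ] V) := by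
    rw [hU]
    have h1 : star (1 - (1 + z) • A) = 1 - star (1 + z) • A := by
      rw [star_sub, star_one, star_smul, hA.star_eq]
    rw [h1]
    exact (Commute.one_left _).sub_left ((Commute.one_right _).sub_right
      (((Commute.refl A).smul_left _).smul_right _))
  have hcomm' : Commute (star U) U := Units.ext hcomm
  have hnormal : IsStarNormal ((U⁻¹ : (V →L[ℂ] V)ˣ) : V →L[ℂ] V) := by
    refine ⟨?_⟩
    have h1 : Commute (star U⁻¹) U⁻¹ := by
      rw [star_inv]; exact hcomm'.inv_inv
    exact congrArg Units.val h1
  have hspec : ∀ w ∈ spectrum ℂ ((U⁻¹ : (V →L[ℂ] V)ˣ) : V →L[ℂ] V),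
      ‖w‖ ≤ (1 + ‖l‖) / ‖z - l‖ := by
    intro w hw
    rw [le_div_iff₀ hzl']
    have hr2 : ‖z - l‖ * (2 * (1 + d)) < d := (lt_div_iff₀ (by positivity)).1 hzr
    have hw0 : w ≠ 0 := fun h => spectrum.zero_notMem ℂ (Units.isUnit U⁻¹) (h ▸ hw)
    by_cases hw1 : w = 1
    · rw [hw1, norm_one]
      nlinarith [norm_nonneg l]
    have hw' : w⁻¹ ∈ spectrum ℂ (U : V →L[ℂ] V) := by
      have h1 := (spectrum.inv_mem_iff (r := Units.mk0 w hw0) (a := U⁻¹)).1 hw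
      simpa using h1
    have hz1 : w - 1 ≠ 0 := sub_ne_zero.2 hw1
    -- `w = (1 + μ) / (μ - z)` for the following `μ`
    obtain ⟨μ, hμ⟩ : ∃ μ, μ = (1 + w * z) / (w - 1) := ⟨_, rfl⟩
    have hμw : w * (μ - z) = 1 + μ := by
      rw [hμ]; field_simp; ring
    have hμU : ¬ IsUnit (1 - (1 + μ) • A) := by
      intro h
      refine hw' ?_
      rw [spectrum.mem_resolventSet_iff, Algebra.algebraMap_eq_smul_one, hU]
      have h1 : (w⁻¹ • (1 : V →L[ℂ] V) - (1 - (1 + z) • A)) =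
          (w⁻¹ * (1 - w)) • (1 - (1 + μ) • A) := by
        have h2 : w⁻¹ * (1 - w) * (1 + μ) = -(1 + z) := by
          field_simp
          linear_combination -hμw
        have h3 : w⁻¹ * (1 - w) = w⁻¹ - 1 := by field_simp
        rw [smul_sub, smul_smul, h2, h3]
        module
      rw [h1]
      exact h.smul (Units.mk0 (w⁻¹ * (1 - w)) (mul_ne_zero (inv_ne_zero hw0)
        (sub_ne_zero.2 (Ne.symm hw1))))
    have hn : ‖w‖ * ‖μ - z‖ = ‖1 + μ‖ := by rw [← norm_mul, hμw]
    by_cases hμl : μ = l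
    · rw [hμl, norm_sub_rev] at hn
      rw [hn]
      exact (norm_add_le _ _).trans (by rw [norm_one])
    have hdμ : d ≤ ‖μ - l‖ := by
      by_contra! h
      exact hμU (hball ⟨by rwa [Metric.mem_ball, dist_eq_norm], hμl⟩)
    have h1 : ‖1 + μ‖ ≤ 1 + ‖l‖ + ‖μ - l‖ := by
      have h2 : 1 + μ = 1 + l + (μ - l) := by ring
      rw [h2]
      refine (norm_add_le _ _).trans (add_le_add ((norm_add_le _ _).trans ?_) le_rfl)
      rw [norm_one]
    have h2 : ‖μ - l‖ - ‖z - l‖ ≤ ‖μ - z‖ := by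
      have h3 := norm_sub_norm_le (μ - l) (z - l)
      rwa [sub_sub_sub_cancel_right] at h3
    set r := ‖z - l‖
    set s := ‖μ - l‖
    set c := 1 + ‖l‖
    have hc : 1 ≤ c := le_add_of_nonneg_right (norm_nonneg l)
    have hs : 0 < s := hd.trans_le hdμ
    have hrs : r * (2 * (1 + s)) ≤ s := by
      have h4 : r * (2 * (1 + s)) * (1 + d) ≤ d * (1 + s) := by nlinarith
      have h5 : d * (1 + s) ≤ s * (1 + d) := by nlinarith
      exact le_of_mul_le_mul_right (h4.trans h5) (by positivity)
    have h4 : r * (1 + s) ≤ s - r := by nlinarith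
    have h5 : ‖w‖ * (r * (1 + s)) ≤ c * (1 + s) :=
      calc ‖w‖ * (r * (1 + s)) ≤ ‖w‖ * ‖μ - z‖ := by gcongr; exact h4.trans h2
        _ ≤ c + s := hn.trans_le h1
        _ ≤ c * (1 + s) := by nlinarith
    rw [← mul_assoc] at h5
    exact le_of_mul_le_mul_right h5 (by positivity)
  have hrad := IsStarNormal.spectralRadius_eq_nnnorm ((U⁻¹ : (V →L[ℂ] V)ˣ) : V →L[ℂ] V)
  have hC : 0 ≤ (1 + ‖l‖) / ‖z - l‖ := by positivity
  have h1 : spectralRadius ℂ ((U⁻¹ : (V →L[ℂ] V)ˣ) : V →L[ℂ] V) ≤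
      (((1 + ‖l‖) / ‖z - l‖).toNNReal : ENNReal) :=
    iSup₂_le fun w hw => ENNReal.coe_le_coe.2 ((Real.le_toNNReal_iff_coe_le hC).2 (hspec w hw))
  rw [hrad] at h1
  exact (Real.le_toNNReal_iff_coe_le hC).1 (ENNReal.coe_le_coe.1 h1)

end Represented

/-! ### The form domain and the Neumann operator -/

section Boundary

open scoped InnerProduct

namespace NonnegForm

variable {H : Type*} [NormedAddCommGroup H] [InnerProductSpace ℂ H] (h : NonnegForm H)

theorem inner_dom (f u : h.Dom) :
    inner ℂ f u = inner ℂ (h.incl f) (h.incl u) + h.sesq f u := rfl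

theorem incl_injective : Function.Injective h.incl := Subtype.val_injective

theorem norm_incl_le (u : h.Dom) : ‖h.incl u‖ ≤ ‖u‖ := by
  have h1 : 0 ≤ (h.sesq u u).re := h.nonneg u
  have h2 := h.norm_sq_eq u
  exact le_of_sq_le_sq (by linarith) (norm_nonneg _)

theorem im_shift_self (z : ℂ) (u : h.Dom) :
    (h.shift z u u).im = -(z.im * ‖h.incl u‖ ^ 2) := by
  have h1 : (h.sesq u u).im = 0 := Complex.conj_eq_iff_im.1 (h.conj_symm u u)
  rw [NonnegForm.shift_apply, inner_self_eq_norm_sq_to_K, Complex.sub_im, h1]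
  simp [← Complex.ofReal_pow]

/-- The inclusion of the form domain into `H`, as a bounded operator. -/
noncomputable def inclL : h.Dom →L[ℂ] H := h.incl.mkContinuous 1 fun u => by
  rw [one_mul]; exact h.norm_incl_le u

theorem inclL_apply (u : h.Dom) : h.inclL u = h.incl u := rfl

end NonnegForm

namespace BoundaryPair

section Algebra

variable {H G : Type*} [NormedAddCommGroup H] [InnerProductSpace ℂ H]
  [NormedAddCommGroup G] [InnerProductSpace ℂ G] (P : BoundaryPair H G)

theorem halfIncl_injective : Function.Injective P.halfIncl := Subtype.val_injective

theorem denseRange_halfIncl : DenseRange P.halfIncl := by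
  have h1 : Set.range P.halfIncl = Set.range P.Γ := Subtype.range_val
  rw [DenseRange, h1]
  exact P.denseRange

theorem S₀_mem (φ : P.Half) : P.S₀ φ ∈ P.kerΓᗮ :=
  ((LinearEquiv.ofBijective _ P.bdry_bijective).symm φ).2

theorem bdry_S₀ (φ : P.Half) : P.bdry (P.S₀ φ) = φ :=
  (LinearEquiv.ofBijective _ P.bdry_bijective).apply_symm_apply φ

theorem sub_S₀_bdry_mem (u : P.h.Dom) : u - P.S₀ (P.bdry u) ∈ P.kerΓ := by
  have h1 : P.Γ u = P.Γ (P.S₀ (P.bdry u)) := by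
    rw [← halfIncl_bdry, ← halfIncl_bdry, bdry_S₀]
  have h2 : P.Γ (u - P.S₀ (P.bdry u)) = 0 := by rw [map_sub, sub_eq_zero]; exact h1
  exact h2

theorem norm_bdry_le (u : P.h.Dom) : ‖P.bdry u‖ ≤ ‖u‖ := by
  rw [norm_half]
  have h1 : inner ℂ (P.S₀ (P.bdry u)) (u - P.S₀ (P.bdry u)) = (0 : ℂ) :=
    Submodule.inner_left_of_mem_orthogonal (P.sub_S₀_bdry_mem u) (P.S₀_mem _)
  have h2 : ‖u‖ * ‖u‖ = ‖P.S₀ (P.bdry u)‖ * ‖P.S₀ (P.bdry u)‖ +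
      ‖u - P.S₀ (P.bdry u)‖ * ‖u - P.S₀ (P.bdry u)‖ := by
    rw [← norm_add_sq_eq_norm_sq_add_norm_sq_of_inner_eq_zero _ _ h1, add_sub_cancel]
  nlinarith [norm_nonneg u, norm_nonneg (P.S₀ (P.bdry u)),
    mul_self_nonneg ‖u - P.S₀ (P.bdry u)‖]

instance : CompleteSpace P.kerΓ :=
  have hc : IsClosed (P.kerΓ : Set P.h.Dom) := P.Γ.isClosed_ker
  hc.completeSpace_coe

/-- The inclusion of `ker Γ` into its closure in `H`, as a bounded operator. -/
noncomputable def dirichletInclL : P.kerΓ →L[ℂ] P.dirichletSpace :=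
  P.dirichletIncl.mkContinuous 1 fun u => by
    rw [one_mul]; exact P.h.norm_incl_le u

theorem dirichletInclL_injective : Function.Injective P.dirichletInclL := fun _ _ h =>
  Subtype.ext (P.h.incl_injective (congrArg (Subtype.val : P.dirichletSpace → H) h))

theorem denseRange_dirichletInclL : DenseRange P.dirichletInclL := by
  refine Subtype.dense_iff.2 ?_
  have h1 : Subtype.val '' Set.range P.dirichletInclL =
      ((P.kerΓ.map P.h.incl : Submodule ℂ H) : Set H) := by
    ext x
    constructor
    · rintro ⟨_, ⟨u, rfl⟩, rfl⟩
      exact ⟨u, u.2, rfl⟩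
    · rintro ⟨u, hu, rfl⟩
      exact ⟨_, ⟨⟨u, hu⟩, rfl⟩, rfl⟩
  exact fun x hx => closure_mono h1.ge hx

end Algebra

variable {H G : Type*} [NormedAddCommGroup H] [InnerProductSpace ℂ H] [CompleteSpace H]
  [NormedAddCommGroup G] [InnerProductSpace ℂ G] (P : BoundaryPair H G)

/-- The Gram operator of the inner product of `H` on the form domain. -/
noncomputable def gram : P.h.Dom →L[ℂ] P.h.Dom := (P.h.inclL)† ∘L P.h.inclL

/-- The operator of the form `h - z` on the form domain, see `inner_shiftOp`. -/
noncomputable def shiftOp (z : ℂ) : P.h.Dom →L[ℂ] P.h.Dom := 1 - (1 + z) • P.gram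

theorem isSelfAdjoint_gram : IsSelfAdjoint P.gram := by
  rw [ContinuousLinearMap.isSelfAdjoint_iff']
  simp [gram, ContinuousLinearMap.adjoint_comp]

theorem inner_gram (f u : P.h.Dom) :
    inner ℂ f (P.gram u) = inner ℂ (P.h.incl f) (P.h.incl u) :=
  ContinuousLinearMap.adjoint_inner_right P.h.inclL f (P.h.inclL u)

theorem inner_shiftOp (z : ℂ) (f u : P.h.Dom) :
    inner ℂ f (P.shiftOp z u) = P.h.shift z f u := by
  change inner ℂ f (u - (1 + z) • P.gram u) = _
  rw [inner_sub_right, inner_smul_right, P.inner_gram, NonnegForm.inner_dom,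
    NonnegForm.shift_apply]
  ring

theorem one_sub_gram_sub (z : ℂ) : 1 - P.gram - z • P.gram = P.shiftOp z :=
  one_sub_sub_smul_eq P.gram z

theorem isRepresentedBy_neumann : P.neumann.IsRepresentedBy P.h.inclL (1 - P.gram) := by
  refine isRepresentedBy_formOperator (J := P.h.inclL) P.h.incl_injective ?_ (t := P.h.sesq)
    fun f u => ?_
  · have h1 : Set.range P.h.inclL = P.h.dom := Subtype.range_val
    rw [DenseRange, h1]
    exact P.dense_dom
  · rw [NonnegForm.inner_dom, NonnegForm.inclL_apply, NonnegForm.inclL_apply, add_sub_cancel_left]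

theorem notMem_neumann_spec {z : ℂ} : z ∉ P.neumann.spec ↔ IsUnit (P.shiftOp z) := by
  rw [← one_sub_gram_sub]
  exact ⟨P.isRepresentedBy_neumann.isUnit_of_notMem_spec P.h.incl_injective,
    P.isRepresentedBy_neumann.notMem_spec⟩

theorem mem_kerNeumann {z : ℂ} {u : P.h.Dom} : u ∈ P.kerNeumann z ↔ P.shiftOp z u = 0 := by
  have h1 : u ∈ P.kerNeumann z ↔ P.h.incl u ∈ P.neumann.eigenspace z := Iff.rfl
  rw [h1, P.isRepresentedBy_neumann.mem_eigenspace]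
  change (∃ v, P.h.incl v = P.h.incl u ∧ (1 - P.gram - z • P.gram) v = 0) ↔ _
  rw [one_sub_gram_sub]
  constructor
  · rintro ⟨v, hv, hv'⟩
    rwa [← P.h.incl_injective hv]
  · exact fun h => ⟨u, rfl, h⟩

theorem exists_mem_kerNeumann (z : ℂ) {x : H} (hx : x ∈ P.neumann.eigenspace z) :
    ∃ u ∈ P.kerNeumann z, P.h.incl u = x := by
  obtain ⟨u, rfl, -⟩ := P.isRepresentedBy_neumann.mem_eigenspace.1 hx
  exact ⟨u, hx, rfl⟩

/-- On the kernel of `H^N - l` the norms of `H` and of the form domain are equivalent, since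
`u = (1 + l) J† J u` there, where `J` is the inclusion of the form domain. -/
theorem exists_kerNeumann_equiv_eigenspace (l : ℂ) :
    ∃ e : P.kerNeumann l ≃L[ℂ] P.neumann.eigenspace l, ∀ u, (e u : H) = P.h.incl u := by
  let f : P.kerNeumann l →ₗ[ℂ] P.neumann.eigenspace l := P.h.incl.restrict fun _ hu => hu
  have hf : Function.Bijective f := by
    constructor
    · intro u v huv
      exact Subtype.ext (P.h.incl_injective (congrArg (Subtype.val : P.neumann.eigenspace l → H) huv))
    · rintro ⟨x, hx⟩
      obtain ⟨u, hu, rfl⟩ := P.exists_mem_kerNeumann l hx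
      exact ⟨⟨u, hu⟩, rfl⟩
  refine ⟨(LinearEquiv.ofBijective f hf).toContinuousLinearEquivOfBounds 1
    (‖1 + l‖ * ‖(P.h.inclL)†‖) (fun u => ?_) (fun x => ?_), fun u => rfl⟩
  · rw [one_mul]; exact P.h.norm_incl_le u
  · obtain ⟨u, rfl⟩ := (LinearEquiv.ofBijective f hf).surjective x
    rw [LinearEquiv.symm_apply_apply]
    have h1 : (u : P.h.Dom) - (1 + l) • ((P.h.inclL)†) (P.h.inclL u) = 0 :=
      P.mem_kerNeumann.1 u.2
    change ‖(u : P.h.Dom)‖ ≤ _ * ‖P.h.inclL u‖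
    nth_rewrite 1 [sub_eq_zero.1 h1]
    rw [norm_smul, mul_assoc]
    exact mul_le_mul_of_nonneg_left (ContinuousLinearMap.le_opNorm _ _) (norm_nonneg _)

theorem neumann_isResolvent_neg_one :
    P.neumann.IsResolvent (-1) (P.h.inclL ∘L (P.h.inclL)†) := by
  refine P.isRepresentedBy_neumann.isResolvent 1 ?_
  have h1 := P.one_sub_gram_sub (-1)
  exact (h1.trans (by rw [shiftOp, add_neg_cancel]; exact sub_eq_self.2 (zero_smul ℂ P.gram))).symm

/-- The form domain is compactly embedded if the resolvent of `H^N` is compact. -/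
theorem isCompactOperator_inclL {R : H →L[ℂ] H} (hR : P.neumann.IsResolvent (-1) R)
    (hc : IsCompactOperator R) : IsCompactOperator P.h.inclL := by
  rw [hR.unique P.neumann_isResolvent_neg_one] at hc
  have h1 : IsCompactOperator ((P.h.inclL)†) :=
    IsCompactOperator.of_adjoint_comp_self (by rwa [ContinuousLinearMap.adjoint_adjoint])
  exact IsCompactOperator.of_adjoint_comp_self (h1.comp_clm P.h.inclL)

/-! ### The Dirichlet operator -/

instance : CompleteSpace P.dirichletSpace :=
  (Submodule.isClosed_topologicalClosure (P.kerΓ.map P.h.incl)).completeSpace_coe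

theorem isRepresentedBy_dirichlet :
    P.dirichlet.IsRepresentedBy P.dirichletInclL
      (1 - (P.dirichletInclL)† ∘L P.dirichletInclL) := by
  refine isRepresentedBy_formOperator (J := P.dirichletInclL) P.dirichletInclL_injective
    P.denseRange_dirichletInclL fun f u => ?_
  have h1 : (inner ℂ f u : ℂ) = inner ℂ (P.h.incl f) (P.h.incl u) + P.h.sesq f u := rfl
  have h2 : (inner ℂ (P.dirichletInclL f) (P.dirichletInclL u) : ℂ) =
    inner ℂ (P.h.incl f) (P.h.incl u) := rfl
  rw [h1, h2, add_sub_cancel_left]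
  rfl

/-- The operator of the form `h - z` on `ker Γ`, see `inner_dirichletShiftOp`. -/
noncomputable def dirichletShiftOp (z : ℂ) : P.kerΓ →L[ℂ] P.kerΓ :=
  1 - (P.dirichletInclL)† ∘L P.dirichletInclL - z • ((P.dirichletInclL)† ∘L P.dirichletInclL)

theorem notMem_dirichlet_spec {z : ℂ} :
    z ∉ P.dirichlet.spec ↔ IsUnit (P.dirichletShiftOp z) :=
  ⟨P.isRepresentedBy_dirichlet.isUnit_of_notMem_spec P.dirichletInclL_injective,
    P.isRepresentedBy_dirichlet.notMem_spec⟩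

theorem inner_dirichletShiftOp (z : ℂ) (f u : P.kerΓ) :
    inner ℂ f (P.dirichletShiftOp z u) = P.h.shift z f u := by
  have h1 : (inner ℂ f u : ℂ) = inner ℂ (P.h.incl f) (P.h.incl u) + P.h.sesq f u := rfl
  have h2 : (inner ℂ (P.dirichletInclL f) (P.dirichletInclL u) : ℂ) =
    inner ℂ (P.h.incl f) (P.h.incl u) := rfl
  refine (inner_one_sub_sub_smul P.dirichletInclL z f u).trans ?_
  rw [h1, h2, NonnegForm.shift_apply]
  ring

theorem isOpen_compl_dirichlet_spec : IsOpen (P.dirichlet.spec)ᶜ := by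
  have h1 : (P.dirichlet.spec)ᶜ = {z | IsUnit (P.dirichletShiftOp z)} := by
    ext z; exact P.notMem_dirichlet_spec
  rw [h1]
  exact isOpen_isUnit_one_sub_sub_smul ((P.dirichletInclL)† ∘L P.dirichletInclL)

theorem dirichlet_hasPurelyDiscreteSpec (hc : IsCompactOperator P.h.inclL) :
    P.dirichlet.HasPurelyDiscreteSpec := by
  have h1 : IsCompactOperator P.dirichletInclL :=
    (hc.comp_clm P.kerΓ.subtypeL).codRestrict (V := P.dirichletSpace)
      (fun u => (P.dirichletInclL u).2) (Submodule.isClosed_topologicalClosure _)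
  have h2 := P.isRepresentedBy_dirichlet.isResolvent (z := -1) 1 (by
    rw [neg_one_smul, sub_neg_eq_add, sub_add_cancel]; rfl)
  exact h2.hasPurelyDiscreteSpec (isCompactOperator_comp_comp_adjoint h1 _)

/-! ### The Dirichlet solution operator -/

/-- Outside the Dirichlet spectrum a weak solution `u` is controlled by its boundary value: it
differs from the weak solution `w` at `-1` with the same boundary value by an element `k` of
`ker Γ`, which solves a Dirichlet problem with right-hand side `- (h - z) w`. -/
theorem exists_norm_le_of_mem_weakSol {z : ℂ} (hz : z ∉ P.dirichlet.spec) :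
    ∃ c : ℝ, ∀ u ∈ P.weakSol z, ‖u‖ ≤ c * ‖P.bdry u‖ := by
  obtain ⟨U, hU⟩ := P.notMem_dirichlet_spec.1 hz
  refine ⟨1 + ‖((U⁻¹ : (P.kerΓ →L[ℂ] P.kerΓ)ˣ) : P.kerΓ →L[ℂ] P.kerΓ)‖ * ‖P.shiftOp z‖,
    fun u hu => ?_⟩
  rw [norm_half]
  set w := P.S₀ (P.bdry u)
  obtain ⟨k, hk⟩ : ∃ k : P.kerΓ, (k : P.h.Dom) = u - w := ⟨⟨_, P.sub_S₀_bdry_mem u⟩, rfl⟩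
  have h1 : ‖P.dirichletShiftOp z k‖ ≤ ‖P.shiftOp z‖ * ‖w‖ := by
    set g := P.dirichletShiftOp z k with hg
    have h2 : inner ℂ g g = -inner ℂ (g : P.h.Dom) (P.shiftOp z w) := by
      nth_rewrite 2 [hg]
      rw [inner_dirichletShiftOp, inner_shiftOp, hk, map_sub, hu _ g.2, zero_sub]
    have h3 : ‖g‖ * ‖g‖ ≤ ‖g‖ * (‖P.shiftOp z‖ * ‖w‖) := by
      rw [← inner_self_eq_norm_mul_norm (𝕜 := ℂ), h2]
      refine (RCLike.re_le_norm _).trans ?_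
      rw [norm_neg]
      refine (norm_inner_le_norm _ _).trans ?_
      exact mul_le_mul_of_nonneg_left ((P.shiftOp z).le_opNorm w) (norm_nonneg _)
    rcases (norm_nonneg g).eq_or_lt with h4 | h4
    · rw [← h4]; positivity
    · exact le_of_mul_le_mul_left h3 h4
  have h2 : k = ((U⁻¹ : (P.kerΓ →L[ℂ] P.kerΓ)ˣ) : P.kerΓ →L[ℂ] P.kerΓ)
      (P.dirichletShiftOp z k) := by
    rw [← hU]
    exact (congrArg (fun f : P.kerΓ →L[ℂ] P.kerΓ => f k) U.inv_mul).symm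
  have h3 : ‖(k : P.h.Dom)‖ ≤ ‖((U⁻¹ : (P.kerΓ →L[ℂ] P.kerΓ)ˣ) : P.kerΓ →L[ℂ] P.kerΓ)‖ *
      (‖P.shiftOp z‖ * ‖w‖) := by
    change ‖k‖ ≤ _
    nth_rewrite 1 [h2]
    exact (ContinuousLinearMap.le_opNorm _ _).trans
      (mul_le_mul_of_nonneg_left h1 (ContinuousLinearMap.opNorm_nonneg _))
  have h4 : u = w + k := by rw [hk]; abel
  calc ‖u‖ ≤ ‖w‖ + ‖(k : P.h.Dom)‖ := by
        nth_rewrite 1 [h4]; exact norm_add_le _ _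
    _ ≤ _ := by linarith

theorem eq_zero_of_mem_weakSol {z : ℂ} (hz : z ∉ P.dirichlet.spec) {u : P.h.Dom}
    (hu : u ∈ P.weakSol z) (hu0 : P.bdry u = 0) : u = 0 := by
  obtain ⟨c, hc⟩ := P.exists_norm_le_of_mem_weakSol hz
  have h1 := hc u hu
  rw [hu0, norm_zero, mul_zero] at h1
  exact norm_le_zero_iff.1 h1

theorem S_apply_bdry {z : ℂ} (hz : z ∉ P.dirichlet.spec) {u : P.h.Dom} (hu : u ∈ P.weakSol z) :
    ∃ h : P.bdry u ∈ (P.S z).domain, P.S z ⟨P.bdry u, h⟩ = u := by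
  have hker : (LinearPMap.mk (P.weakSol z) (P.bdry.comp (P.weakSol z).subtype)).toFun.ker = ⊥ :=
    LinearMap.ker_eq_bot'.2 fun v hv => Subtype.ext (P.eq_zero_of_mem_weakSol hz v.2 hv)
  have hdom : P.bdry u ∈ (P.S z).domain := by
    unfold BoundaryPair.S
    rw [LinearPMap.inverse_domain]
    exact ⟨⟨u, hu⟩, rfl⟩
  exact ⟨hdom, LinearPMap.inverse_apply_eq hker (x := ⟨u, hu⟩) rfl⟩

theorem exists_mem_weakSol {z : ℂ} (hz : z ∉ P.dirichlet.spec) (φ : (P.S z).domain) :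
    P.S z φ ∈ P.weakSol z ∧ P.bdry (P.S z φ) = φ := by
  have h1 : (φ : P.Half) ∈
      (LinearPMap.mk (P.weakSol z) (P.bdry.comp (P.weakSol z).subtype)).toFun.range := by
    rw [← LinearPMap.inverse_domain]
    exact φ.2
  obtain ⟨⟨u, hu⟩, hφ⟩ := h1
  change P.bdry u = φ at hφ
  obtain ⟨h2, h3⟩ := P.S_apply_bdry hz hu
  have h4 : φ = ⟨P.bdry u, h2⟩ := Subtype.ext hφ.symm
  rw [h4, h3]
  exact ⟨hu, rfl⟩

theorem weakSol_of_shiftOp {z : ℂ} {u : P.h.Dom} (hu : P.shiftOp z u = 0) : u ∈ P.weakSol z := by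
  intro f _
  rw [← inner_shiftOp, hu, inner_zero_right]

theorem kerNeumann_le_weakSol (l : ℂ) : P.kerNeumann l ≤ P.weakSol l := fun _ hu =>
  P.weakSol_of_shiftOp (P.mem_kerNeumann.1 hu)

/-! ### The Dirichlet-to-Neumann operator -/

variable [CompleteSpace G]

theorem isRepresentedBy_dtn {z : ℂ} (hz : z ∉ P.dirichlet.spec) :
    (P.dtn z).IsRepresentedBy P.Γ (P.shiftOp z) := by
  intro x y
  rw [dtn, formOperator_graph _ _ _
    (P.halfIncl_injective.comp Subtype.val_injective : Function.Injective
      (P.halfIncl.comp (P.S z).domain.subtype)) P.denseRange_halfIncl]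
  constructor
  · rintro ⟨φ, hφ, h⟩
    obtain ⟨h1, h2⟩ := P.exists_mem_weakSol hz φ
    refine ⟨P.S z φ, ?_, ?_⟩
    · rw [← halfIncl_bdry, h2]; exact hφ
    · refine ext_inner_left ℂ fun f => ?_
      rw [ContinuousLinearMap.adjoint_inner_right, inner_shiftOp]
      have h3 := h (P.bdry f)
      have h4 := h1 _ (P.sub_S₀_bdry_mem f)
      rw [map_sub, LinearMap.sub_apply, sub_eq_zero] at h4
      rw [h4]
      exact h3
  · rintro ⟨u, rfl, h⟩
    have hsh : ∀ f, P.h.shift z f u = inner ℂ (P.Γ f) y := fun f => by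
      rw [← inner_shiftOp, h, ContinuousLinearMap.adjoint_inner_right]
    have hu : u ∈ P.weakSol z := by
      intro f hf
      have h1 : P.Γ f = 0 := hf
      rw [hsh, h1, inner_zero_left]
    obtain ⟨h1, h2⟩ := P.S_apply_bdry hz hu
    refine ⟨⟨_, h1⟩, rfl, fun ψ => ?_⟩
    change P.h.shift z (P.S₀ ψ) (P.S z ⟨_, h1⟩) = inner ℂ (P.halfIncl ψ) y
    rw [h2, hsh, ← halfIncl_bdry, bdry_S₀]

end BoundaryPair

end Boundary

section Main

open scoped InnerProduct

namespace BoundaryPair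

variable {H G : Type*} [NormedAddCommGroup H] [InnerProductSpace ℂ H] [CompleteSpace H]
  [NormedAddCommGroup G] [InnerProductSpace ℂ G] [CompleteSpace G] (P : BoundaryPair H G)

/-! ### The kernels -/

theorem mem_dtn_eigenspace_zero {l : ℂ} (hl : l ∉ P.dirichlet.spec) {x : G} :
    x ∈ (P.dtn l).eigenspace 0 ↔ ∃ u ∈ P.kerNeumann l, P.Γ u = x := by
  rw [(P.isRepresentedBy_dtn hl).mem_eigenspace, zero_smul, sub_zero]
  exact exists_congr fun u => by rw [mem_kerNeumann, and_comm]

/-- The boundary map is an isomorphism from the kernel of `H^N - l` onto the kernel of `Λ(l)`. -/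
theorem exists_kerNeumann_equiv_kerDtn {l : ℂ} (hl : l ∉ P.dirichlet.spec) :
    ∃ e : P.kerNeumann l ≃L[ℂ] P.kerDtn l, ∀ u, (e u : P.Half) = P.bdry u := by
  have hmem : ∀ u ∈ P.kerNeumann l, P.bdry u ∈ P.kerDtn l := fun u hu =>
    (P.mem_dtn_eigenspace_zero hl).2 ⟨u, hu, rfl⟩
  let f : P.kerNeumann l →ₗ[ℂ] P.kerDtn l := P.bdry.restrict hmem
  have hf : Function.Bijective f := by
    constructor
    · refine (injective_iff_map_eq_zero f).2 fun u hu => Subtype.ext ?_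
      exact P.eq_zero_of_mem_weakSol hl (P.kerNeumann_le_weakSol l u.2) (congrArg Subtype.val hu)
    · rintro ⟨φ, hφ⟩
      obtain ⟨u, hu, hu'⟩ := (P.mem_dtn_eigenspace_zero hl).1 hφ
      exact ⟨⟨u, hu⟩, Subtype.ext (P.halfIncl_injective hu')⟩
  obtain ⟨c, hc⟩ := P.exists_norm_le_of_mem_weakSol hl
  refine ⟨(LinearEquiv.ofBijective f hf).toContinuousLinearEquivOfBounds 1 c (fun u => ?_)
    (fun φ => ?_), fun u => rfl⟩
  · rw [one_mul]; exact P.norm_bdry_le u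
  · obtain ⟨u, rfl⟩ := (LinearEquiv.ofBijective f hf).surjective φ
    rw [LinearEquiv.symm_apply_apply]
    exact hc u (P.kerNeumann_le_weakSol l u.2)

theorem nonempty_kerDtn_equiv_eigenspace {l : ℂ} (hl : l ∉ P.dirichlet.spec) :
    Nonempty (P.kerDtn l ≃ₗ[ℂ] (P.dtn l).eigenspace 0) := by
  let f : P.kerDtn l →ₗ[ℂ] (P.dtn l).eigenspace 0 := P.halfIncl.restrict fun _ hφ => hφ
  refine ⟨LinearEquiv.ofBijective f ⟨fun φ ψ h => ?_, ?_⟩⟩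
  · exact Subtype.ext (P.halfIncl_injective (congrArg (Subtype.val : (P.dtn l).eigenspace 0 → G) h))
  · rintro ⟨x, hx⟩
    obtain ⟨u, hu, rfl⟩ := (P.mem_dtn_eigenspace_zero hl).1 hx
    exact ⟨⟨P.bdry u, hx⟩, rfl⟩

/-! ### The compact case -/

/-- The operator `Λ(l)` has a compact resolvent at `i` or at `-i`, whichever lies in the closed
half-plane of `l`: the form `h - l - ζ ‖Γ ·‖²` has an imaginary part of one sign, and the
corresponding operator on the form domain is a compact perturbation of the identity. -/
theorem dtn_hasPurelyDiscreteSpec {l : ℂ} (hl : l ∉ P.dirichlet.spec)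
    (hc : IsCompactOperator P.h.inclL) (hΓ : IsCompactOperator P.Γ) :
    (P.dtn l).HasPurelyDiscreteSpec := by
  obtain ⟨ζ, hζ0, hζ⟩ : ∃ ζ : ℂ, ζ.im ≠ 0 ∧ 0 ≤ l.im * ζ.im := by
    rcases le_total 0 l.im with h | h
    · exact ⟨Complex.I, by simp, by simpa using h⟩
    · exact ⟨-Complex.I, by simp, by simpa using h⟩
  have hinj : ∀ u, (P.shiftOp l - ζ • ((P.Γ)† ∘L P.Γ)) u = 0 → u = 0 := by
    intro u hu
    have h1 : P.shiftOp l u = ζ • ((P.Γ)†) (P.Γ u) := sub_eq_zero.1 hu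
    have h2 : P.h.shift l u u = ζ * (‖P.Γ u‖ : ℂ) ^ 2 := by
      rw [← inner_shiftOp, h1, inner_smul_right, ContinuousLinearMap.adjoint_inner_right,
        inner_self_eq_norm_sq_to_K]
      rfl
    have h3 : -(l.im * ‖P.h.incl u‖ ^ 2) = ζ.im * ‖P.Γ u‖ ^ 2 := by
      rw [← NonnegForm.im_shift_self, h2, ← Complex.ofReal_pow, Complex.im_mul_ofReal]
    have h4 : ζ.im ^ 2 * ‖P.Γ u‖ ^ 2 ≤ 0 := by
      have h5 : ζ.im ^ 2 * ‖P.Γ u‖ ^ 2 = -((l.im * ζ.im) * ‖P.h.incl u‖ ^ 2) := by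
        linear_combination -ζ.im * h3
      rw [h5]
      exact neg_nonpos.2 (by positivity)
    have h5 : ‖P.Γ u‖ ^ 2 ≤ 0 := by
      have h6 : 0 < ζ.im ^ 2 := by positivity
      nlinarith
    have h6 : P.Γ u = 0 := norm_eq_zero.1 (pow_eq_zero_iff two_ne_zero |>.1
      (le_antisymm h5 (by positivity)))
    rw [h6, map_zero, smul_zero] at h1
    exact P.eq_zero_of_mem_weakSol hl (P.weakSol_of_shiftOp h1) (P.halfIncl_injective h6)
  have hcomp : IsCompactOperator ((1 + l) • P.gram + ζ • ((P.Γ)† ∘L P.Γ)) :=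
    ((hc.clm_comp ((P.h.inclL)†)).smul (1 + l)).add ((hΓ.clm_comp ((P.Γ)†)).smul ζ)
  have heq : P.shiftOp l - ζ • ((P.Γ)† ∘L P.Γ) =
      1 - ((1 + l) • P.gram + ζ • ((P.Γ)† ∘L P.Γ)) := sub_sub _ _ _
  rw [heq] at hinj
  obtain ⟨U, hU⟩ := hcomp.isUnit_one_sub hinj
  exact ((P.isRepresentedBy_dtn hl).isResolvent U (hU.trans heq.symm)).hasPurelyDiscreteSpec
    (isCompactOperator_comp_comp_adjoint hΓ _)

/-! ### The inverse of the Dirichlet-to-Neumann operator near an isolated point -/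

theorem eventually_norm_dtn_inverse_le {l : ℂ} (hl : l ∉ P.dirichlet.spec)
    (hiso : IsIsolatedIn l P.neumann.spec) :
    ∀ᶠ z in 𝓝[≠] l, z ∉ P.dirichlet.spec ∧ z ∉ P.neumann.spec ∧
      ∃ B : G →L[ℂ] G, (P.dtn z).IsResolvent 0 B ∧
        ‖B‖ ≤ ‖P.Γ‖ ^ 2 * ((1 + ‖l‖) / ‖z - l‖) := by
  have h1 : ∀ᶠ z in 𝓝[≠] l, IsUnit (P.shiftOp z) :=
    hiso.2.mono fun z hz => P.notMem_neumann_spec.1 hz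
  have h2 : ∀ᶠ z in 𝓝[≠] l, z ∉ P.dirichlet.spec :=
    nhdsWithin_le_nhds (P.isOpen_compl_dirichlet_spec.mem_nhds hl)
  filter_upwards [h2, hiso.2, eventually_norm_inverse_le P.isSelfAdjoint_gram h1]
    with z hzD hzN ⟨U, hU, hUn⟩
  refine ⟨hzD, hzN, _, (P.isRepresentedBy_dtn hzD).isResolvent (z := 0) U ?_,
    (norm_comp_comp_adjoint_le _ _).trans ?_⟩
  · rw [zero_smul, sub_zero]; exact hU
  · exact mul_le_mul_of_nonneg_left hUn (by positivity)

end BoundaryPair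

end Main

theorem mainTheorem2 :
    ∃ C : ℝ → ℂ → Set ℂ → ℝ, (∀ a l s, 0 < C a l s) ∧
      ∀ (H : Type u) [NormedAddCommGroup H] [InnerProductSpace ℂ H] [CompleteSpace H]
        (G : Type v) [NormedAddCommGroup G] [InnerProductSpace ℂ G] [CompleteSpace G]
        (P : BoundaryPair H G) (l : ℂ), l ∉ P.dirichlet.spec →
        -- (i) `S(l)` is a topological isomorphism with inverse `Γ`; for the norm of the form domain
        -- and for the norm of `H` on the target
        ((∃ e : P.kerDtn l ≃L[ℂ] P.kerNeumann l,
            (∀ φ : P.kerDtn l, ∃ hφ : (φ : P.Half) ∈ (P.S l).domain, (e φ : P.h.Dom) = P.S l ⟨φ, hφ⟩) ∧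
            ∀ u : P.kerNeumann l, (e.symm u : P.Half) = P.bdry u) ∧
          (∃ e : P.kerDtn l ≃L[ℂ] P.neumann.eigenspace l,
            ∀ φ : P.kerDtn l, ∃ hφ : (φ : P.Half) ∈ (P.S l).domain, (e φ : H) = P.h.incl (P.S l ⟨φ, hφ⟩)) ∧
          (l ∈ P.neumann.pointSpec ↔ 0 ∈ (P.dtn l).pointSpec) ∧
          Cardinal.lift.{v} (Module.rank ℂ (P.neumann.eigenspace l)) =
            Cardinal.lift.{u} (Module.rank ℂ ((P.dtn l).eigenspace 0))) ∧
        -- (ii) the compact case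
        ((∃ R : H →L[ℂ] H, P.neumann.IsResolvent (-1) R ∧ IsCompactOperator R) →
          IsCompactOperator P.Γ →
          P.neumann.HasPurelyDiscreteSpec ∧ P.dirichlet.HasPurelyDiscreteSpec ∧
          (P.dtn l).HasPurelyDiscreteSpec ∧
          (l ∈ P.neumann.discSpec ↔ 0 ∈ (P.dtn l).discSpec) ∧
          (l ∈ P.neumann.spec ↔ 0 ∈ (P.dtn l).spec)) ∧
        -- (iii) the norm of the inverse near an isolated point
        (IsIsolatedIn l P.neumann.spec →
          ∀ᶠ z in 𝓝[≠] l, z ∉ P.dirichlet.spec ∧ z ∉ P.neumann.spec ∧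
            ∃ B : G →L[ℂ] G, (P.dtn z).IsResolvent 0 B ∧
              ‖B‖ ≤ C ‖P.Γ‖ l P.neumann.spec / ‖z - l‖) := by
  refine ⟨fun a l _ => a ^ 2 * (1 + ‖l‖) + 1, fun a l _ => by positivity, ?_⟩
  intro H _ _ _ G _ _ _ P l hl
  obtain ⟨e, he⟩ := P.exists_kerNeumann_equiv_kerDtn hl
  obtain ⟨e₁, he₁⟩ := P.exists_kerNeumann_equiv_eigenspace l
  obtain ⟨e₂⟩ := P.nonempty_kerDtn_equiv_eigenspace hl
  have hS : ∀ φ : P.kerDtn l, ∃ hφ : (φ : P.Half) ∈ (P.S l).domain,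
      (e.symm φ : P.h.Dom) = P.S l ⟨φ, hφ⟩ := by
    intro φ
    obtain ⟨u, rfl⟩ := e.surjective φ
    obtain ⟨h1, h2⟩ := P.S_apply_bdry hl (P.kerNeumann_le_weakSol l u.2)
    rw [e.symm_apply_apply, he]
    exact ⟨h1, h2.symm⟩
  let E : P.neumann.eigenspace l ≃ₗ[ℂ] (P.dtn l).eigenspace 0 :=
    (e₁.symm.trans e).toLinearEquiv.trans e₂
  have hpoint : l ∈ P.neumann.pointSpec ↔ 0 ∈ (P.dtn l).pointSpec := by
    change P.neumann.eigenspace l ≠ ⊥ ↔ (P.dtn l).eigenspace 0 ≠ ⊥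
    rw [← Submodule.nontrivial_iff_ne_bot, ← Submodule.nontrivial_iff_ne_bot]
    exact E.toEquiv.nontrivial_congr
  refine ⟨⟨⟨e.symm, hS, fun u => he u⟩, ⟨e.symm.trans e₁, fun φ => ?_⟩, hpoint, E.lift_rank_eq⟩,
    ?_, ?_⟩
  · obtain ⟨h1, h2⟩ := hS φ
    exact ⟨h1, by rw [← h2]; exact he₁ _⟩
  · rintro ⟨R, hR, hRc⟩ hΓ
    have hc := P.isCompactOperator_inclL hR hRc
    have hN := hR.hasPurelyDiscreteSpec hRc
    have hL := P.dtn_hasPurelyDiscreteSpec hl hc hΓ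
    have hdisc : l ∈ P.neumann.discSpec ↔ 0 ∈ (P.dtn l).discSpec := by
      rw [hN.discSpec_eq, hL.discSpec_eq]; exact hpoint
    refine ⟨hN, P.dirichlet_hasPurelyDiscreteSpec hc, hL, hdisc, ?_⟩
    rw [show P.neumann.spec = _ from hN, show (P.dtn l).spec = _ from hL]
    exact hdisc
  · intro hiso
    filter_upwards [P.eventually_norm_dtn_inverse_le hl hiso] with z ⟨hzD, hzN, B, hB, hBn⟩
    refine ⟨hzD, hzN, B, hB, hBn.trans ?_⟩
    rw [← mul_div_assoc]
    gcongr
    exact le_add_of_nonneg_right zero_le_one
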